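/- Let $d\in\mathbb N$, $a,b>0$, and let $\mathcal M^s(\mathbb R^d)$ be the space of finite signed Radon measures on $\mathbb R^d$. For $\mu\in\mathcal M^s(\mathbb R^d)$ with Jordan decomposition $\mu=\mu^+-\mu^-$, let $|\mu|=\mu^+(\mathbb R^d)+\mu^-(\mathbb R^d)$ be its mass, $\operatorname{supp}\mu$ the support of $\mu^++\mu^-$, and $\|\mu\|^{a,b}=W_1^{a,b}(\mu^+,\mu^-)$, where for finite positive Borel measures $\mu,\nu$ $$W_1^{a,b}(\mu,\nu)=\inf\big\{a(|\mu-\tilde\mu|+|\nu-\tilde\nu|)+b\,W_1(\tilde\mu,\tilde\nu)\big\},$$ the infimum being over finite positive Borel measures $\tilde\mu,\tilde\nu$ of equal mass, and $W_1(\tilde\mu,\tilde\nu)=\inf_\pi\int|x-y|\,d\pi(x,y)$ over the measures $\pi$ on $\mathbb R^d\times\mathbb R^d$ with marginals $\tilde\mu,\tilde\nu$. Write $B_0(r)=\{x:|x|\le r\}$. Let $v$ assign to each $\mu\in\mathcal M^s(\mathbb R^d)$ a vector field $v[\mu]:\mathbb R^d\to\mathbb R^d$ and let $h:\mathcal M^s(\mathbb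 R^d)\to\mathcal M^s(\mathbb R^d)$, with constants $K,L,M,Q,P,R$ such that for all $\mu,\nu\in\mathcal M^s(\mathbb R^d)$ and $x,y\in\mathbb R^d$: (H-1) $|v[\mu](x)-v[\nu](x)|\le K\|\mu-\nu\|^{a,b}$; (H-2) $|v[\mu](x)-v[\mu](y)|\le L|x-y|$ and $|v[\mu](x)|\le M$; (H-3) $\|h[\mu]-h[\nu]\|^{a,b}\le Q\|\mu-\nu\|^{a,b}$, $|h[\mu]|\le P$ and $\operatorname{supp}h[\mu]\subset B_0(R)$. Let $\mu_0\in\mathcal M^s(\mathbb R^d)$ have compact support. For a bounded Lipschitz vector field $w$, let $\Phi^w_t$ be its flow: $\frac{d}{dt}\Phi^w_t=w(\Phi^w_t)$, $\Phi^w_0=\mathrm{Id}$. For $k\in\mathbb N$ put $\Delta t=2^{-k}$ and define $(\mu^k_t)_{t\in[0,1]}$ by $\mu^k_0=\mu_0$ and, for $i=0,\dots,2^k-1$, $$\mu^k_t=\Phi^{v[\mu^k_{i\Delta t}]}_{t-i\Delta t}\#\mu^k_{i\Delta t}+(t-i\Delta t)\,h[\mu^k_{i\Delta t}],\qquad t\in[i\Delta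 t,(i+1)\Delta t].$$ Then $(\mu^k)_{k}$ is a Cauchy sequence in $\mathcal C^0([0,1],(\mathcal M^s(\mathbb R^d),\|\cdot\|^{a,b}))$ for the norm $\|\mu\|=\sup_{t\in[0,1]}\|\mu_t\|^{a,b}$: each $t\mapsto\mu^k_t$ is continuous on $[0,1]$ for $\|\cdot\|^{a,b}$, and for every $\varepsilon>0$ there is $N$ such that $\sup_{t\in[0,1]}\|\mu^m_t-\mu^n_t\|^{a,b}<\varepsilon$ for all $m,n\ge N$. Moreover, for all $k\in\mathbb N$ and $t\in[0,1]$, $$|\mu^k_t|\le|\mu_0|+Pt,$$ and, for every $R'$ such that $\operatorname{supp}\mu_0\cup B_0(R)\subset B_0(R')$, $$\operatorname{supp}\mu^k_t\subset B_0(R'+tM).$$ -/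

import Mathlib

open MeasureTheory Filter Set
open scoped ENNReal NNReal Topology

noncomputable section

namespace SignedTransport

/-- The space `ℝ^d` with its Euclidean norm. -/
abbrev Sp (d : ℕ) : Type := EuclideanSpace ℝ (Fin d)

/-- The space `M^s(ℝ^d)` of finite signed Borel measures on `ℝ^d` (a finite Borel measure on `ℝ^d`
is automatically Radon). -/
abbrev Ms (d : ℕ) : Type := SignedMeasure (Sp d)

variable {d : ℕ}

/-! ### Mass and support of a signed measure -/

/-- The mass `|μ| = μ⁺(ℝ^d) + μ⁻(ℝ^d)`, with `(μ⁺, μ⁻)` the Jordan decomposition. -/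
def mass (μ : Ms d) : ℝ := (μ.totalVariation univ).toReal

/-- The support of a signed measure: the support of `μ⁺ + μ⁻`. -/
def supp (μ : Ms d) : Set (Sp d) := μ.totalVariation.support

/-! ### The generalized Wasserstein distance and norm -/

/-- Transference plans between two positive measures. -/
def Plans (μ ν : Measure (Sp d)) : Set (Measure (Sp d × Sp d)) :=
  {π | π.map Prod.fst = μ ∧ π.map Prod.snd = ν}

/-- The Wasserstein distance `W₁` between positive measures of the same mass. -/
def W1 (μ ν : Measure (Sp d)) : ℝ≥0∞ :=
  ⨅ π ∈ Plans μ ν, ∫⁻ z, edist z.1 z.2 ∂π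

/-- The generalized Wasserstein distance `W₁^{a,b}` between finite positive measures: the infimum of
`a (|μ - μ'| + |ν - ν'|) + b W₁(μ', ν')` over finite positive measures `μ', ν'` of equal mass. -/
def genW1 (a b : ℝ) (μ ν : Measure (Sp d)) [IsFiniteMeasure μ] [IsFiniteMeasure ν] : ℝ≥0∞ :=
  ⨅ (μ' : FiniteMeasure (Sp d)) (ν' : FiniteMeasure (Sp d)) (_ : μ'.mass = ν'.mass),
    ENNReal.ofReal (a * (mass (μ.toSignedMeasure - (μ' : Measure (Sp d)).toSignedMeasure) +
      mass (ν.toSignedMeasure - (ν' : Measure (Sp d)).toSignedMeasure))) +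
    ENNReal.ofReal b * W1 (μ' : Measure (Sp d)) (ν' : Measure (Sp d))

lemma W1_zero : W1 (0 : Measure (Sp d)) 0 = 0 := by
  refine le_antisymm ?_ bot_le
  refine (iInf₂_le (0 : Measure (Sp d × Sp d)) ?_).trans (by simp)
  simp [Plans]

/-- `W₁^{a,b}` is always finite. -/
lemma genW1_ne_top (a b : ℝ) (μ ν : Measure (Sp d)) [IsFiniteMeasure μ] [IsFiniteMeasure ν] :
    genW1 a b μ ν ≠ ⊤ := by
  refine ne_top_of_le_ne_top ?_
    (iInf_le_of_le (0 : FiniteMeasure (Sp d)) (iInf_le_of_le 0 (iInf_le_of_le rfl le_rfl)))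
  simp [W1_zero]

/-- The norm `‖μ‖^{a,b} = W₁^{a,b}(μ⁺, μ⁻)` on `M^s(ℝ^d)`. -/
def gNorm (a b : ℝ) (μ : Ms d) : ℝ :=
  (genW1 a b μ.toJordanDecomposition.posPart μ.toJordanDecomposition.negPart).toReal

/-- Membership of a curve in `C⁰([0,1], M^s(ℝ^d))`, for the norm `‖·‖^{a,b}` on `M^s(ℝ^d)`. -/
def IsContCurve (a b : ℝ) (c : ℝ → Ms d) : Prop :=
  ∀ t ∈ Icc (0 : ℝ) 1, Tendsto (fun s => gNorm a b (c s - c t)) (𝓝[Icc 0 1] t) (𝓝 0)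

/-- The norm `sup_{t ∈ [0,1]} ‖μ_t‖^{a,b}` of a curve, as an extended nonnegative number. -/
def supNorm (a b : ℝ) (c : ℝ → Ms d) : ℝ≥0∞ :=
  ⨆ t ∈ Icc (0 : ℝ) 1, ENNReal.ofReal (gNorm a b (c t))

/-- Cauchy sequences of `C⁰([0,1], M^s(ℝ^d))` with the norm `sup_{t ∈ [0,1]} ‖μ_t‖^{a,b}`. -/
def IsCauchyInC0 (a b : ℝ) (c : ℕ → ℝ → Ms d) : Prop :=
  (∀ k, IsContCurve a b (c k)) ∧
    ∀ ε : ℝ, 0 < ε → ∃ N : ℕ, ∀ m ≥ N, ∀ n ≥ N,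
      supNorm a b (fun t => c m t - c n t) < ENNReal.ofReal ε

/-! ### Assumptions on the velocity and on the source -/

/-- `‖v[μ] - v[ν]‖_{C⁰} ≤ K ‖μ - ν‖^{a,b}`. -/
def H1 (a b K : ℝ) (v : Ms d → Sp d → Sp d) : Prop :=
  ∀ μ ν : Ms d, ∀ x, ‖v μ x - v ν x‖ ≤ K * gNorm a b (μ - ν)

/-- `v[μ]` is `L`-Lipschitz and bounded by `M`, uniformly in `μ`. -/
def H2 (L M : ℝ) (v : Ms d → Sp d → Sp d) : Prop :=
  ∀ μ : Ms d, (∀ x y, ‖v μ x - v μ y‖ ≤ L * ‖x - y‖) ∧ ∀ x, ‖v μ x‖ ≤ M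

/-- `h` is `Q`-Lipschitz for `‖·‖^{a,b}`, with mass at most `P` and support in `B₀(R)`. -/
def H3 (a b Q P R : ℝ) (h : Ms d → Ms d) : Prop :=
  (∀ μ ν : Ms d, gNorm a b (h μ - h ν) ≤ Q * gNorm a b (μ - ν)) ∧
    ∀ μ : Ms d, mass (h μ) ≤ P ∧ supp (h μ) ⊆ Metric.closedBall 0 R

/-! ### The flow of a vector field -/

/-- `Φ` is the flow of the autonomous vector field `w`: `d/dt Φ_t = w(Φ_t)`, `Φ_0 = Id`. -/
def IsFlow (w : Sp d → Sp d) (Φ : ℝ → Sp d → Sp d) : Prop :=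
  ∀ x, Φ 0 x = x ∧ ∀ t, HasDerivAt (fun s => Φ s x) (w (Φ t x)) t

open Classical in
/-- The flow `Φ^w` of `w`. It is the unique flow of `w` whenever `w` is bounded and Lipschitz
(see `flow_isFlow` and `IsFlow.unique`); if `w` has no flow, it is the identity by convention. -/
def flow (w : Sp d → Sp d) : ℝ → Sp d → Sp d :=
  if hw : ∃ Φ, IsFlow w Φ then hw.choose else fun _ x => x

lemma flow_zero (w : Sp d → Sp d) : flow w 0 = id := by
  unfold flow
  split_ifs with hw
  · funext x
    exact (hw.choose_spec x).1
  · rfl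

lemma IsFlow.unique {w : Sp d → Sp d} {C : ℝ≥0} (hw : LipschitzWith C w)
    {Φ Ψ : ℝ → Sp d → Sp d} (hΦ : IsFlow w Φ) (hΨ : IsFlow w Ψ) : Φ = Ψ := by
  funext t x
  have := ODE_solution_unique_univ (v := fun _ => w) (s := fun _ => univ) (K := C) (t₀ := 0)
    (f := fun s => Φ s x) (g := fun s => Ψ s x)
    (fun _ => hw.lipschitzOnWith)
    (fun s => ⟨(hΦ x).2 s, mem_univ _⟩) (fun s => ⟨(hΨ x).2 s, mem_univ _⟩)
    (by simp [(hΦ x).1, (hΨ x).1])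
  exact congrFun this t

lemma exists_isFlow {w : Sp d → Sp d} {C B : ℝ≥0} (hw : LipschitzWith C w)
    (hB : ∀ x, ‖w x‖ ≤ B) : ∃ Φ, IsFlow w Φ := by
  have key : ∀ (x : Sp d) (n : ℕ), ∃ α : ℝ → Sp d, α 0 = x ∧
      ∀ t ∈ Ioo (-((n : ℝ) + 1)) (n + 1), HasDerivAt α (w (α t)) t := by
    intro x n
    have hn : (0 : ℝ) ∈ Icc (-((n : ℝ) + 1)) (n + 1) := ⟨by linarith [n.cast_nonneg (α := ℝ)],
      by linarith [n.cast_nonneg (α := ℝ)]⟩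
    have hp : IsPicardLindelof (fun _ => w) (⟨0, hn⟩ : Icc (-((n : ℝ) + 1)) (n + 1)) x
        (B * (n + 1)) 0 B C := by
      refine IsPicardLindelof.of_time_independent (fun y _ => hB y) hw.lipschitzOnWith ?_
      simp
    obtain ⟨α, h0, hα⟩ := hp.exists_eq_forall_mem_Icc_hasDerivWithinAt₀
    exact ⟨α, h0, fun t ht => (hα t ⟨ht.1.le, ht.2.le⟩).hasDerivAt (Icc_mem_nhds ht.1 ht.2)⟩
  choose α h0 hα using key
  have agree : ∀ x (m n : ℕ), m ≤ n → ∀ t ∈ Ioo (-((m : ℝ) + 1)) (m + 1), α x m t = α x n t := by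
    intro x m n hmn
    have hc : (m : ℝ) ≤ n := by exact_mod_cast hmn
    refine ODE_solution_unique_of_mem_Ioo (v := fun _ => w) (s := fun _ => univ) (K := C) (t₀ := 0)
      (fun _ _ => hw.lipschitzOnWith) ⟨by linarith [m.cast_nonneg (α := ℝ)],
        by linarith [m.cast_nonneg (α := ℝ)]⟩ (fun t ht => ⟨hα x m t ht, mem_univ _⟩)
      (fun t ht => ⟨hα x n t ⟨by linarith [ht.1], by linarith [ht.2]⟩, mem_univ _⟩) ?_
    rw [h0, h0]
  refine ⟨fun t x => α x ⌈|t|⌉₊ t, fun x => ⟨h0 x _, fun t => ?_⟩⟩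
  have hmem : ∀ s : ℝ, s ∈ Ioo (-((⌈|s|⌉₊ : ℝ) + 1)) (⌈|s|⌉₊ + 1) := fun s => by
    have := Nat.le_ceil |s|
    exact abs_lt.1 (by linarith)
  refine (hα x _ t (hmem t)).congr_of_eventuallyEq ?_
  filter_upwards [Ioo_mem_nhds (hmem t).1 (hmem t).2] with s hs
  rcases le_total ⌈|s|⌉₊ ⌈|t|⌉₊ with hst | hst
  · exact agree x _ _ hst s (hmem s)
  · exact (agree x _ _ hst s hs).symm

/-- For bounded Lipschitz fields, `flow w` is indeed the flow of `w`. -/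
lemma flow_isFlow {w : Sp d → Sp d} {C B : ℝ≥0} (hw : LipschitzWith C w)
    (hB : ∀ x, ‖w x‖ ≤ B) : IsFlow w (flow w) := by
  have hex := exists_isFlow hw hB
  unfold flow
  rw [dif_pos hex]
  exact hex.choose_spec

/-! ### The operator-splitting scheme -/

/-- One explicit step of length `s` from `μ`: `Φ_s^{v[μ]} # μ + s h[μ]`. -/
def splitStep (v : Ms d → Sp d → Sp d) (h : Ms d → Ms d) (s : ℝ) (μ : Ms d) : Ms d :=
  μ.map (flow (v μ) s) + s • h μ

/-- The values `μ^k_{iΔt}` of the scheme at the grid points, with `Δt = 1 / 2^k`. -/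
def gridVal (v : Ms d → Sp d → Sp d) (h : Ms d → Ms d) (μ₀ : Ms d) (k : ℕ) : ℕ → Ms d
  | 0 => μ₀
  | i + 1 => splitStep v h (1 / 2 ^ k) (gridVal v h μ₀ k i)

/-- The approximate solution `μ^k_t`: if `t` lies in `[iΔt, (i+1)Δt)`, one step of length `t - iΔt`
from `μ^k_{iΔt}`. -/
def scheme (v : Ms d → Sp d → Sp d) (h : Ms d → Ms d) (μ₀ : Ms d) (k : ℕ) (t : ℝ) : Ms d :=
  splitStep v h (t - ⌊t * 2 ^ k⌋₊ * (1 / 2 ^ k)) (gridVal v h μ₀ k ⌊t * 2 ^ k⌋₊)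

lemma splitStep_zero (v : Ms d → Sp d → Sp d) (h : Ms d → Ms d) (μ : Ms d) :
    splitStep v h 0 μ = μ := by
  simp [splitStep, flow_zero, VectorMeasure.map_id]

lemma scheme_grid (v : Ms d → Sp d → Sp d) (h : Ms d → Ms d) (μ₀ : Ms d) (k i : ℕ) :
    scheme v h μ₀ k (i * (1 / 2 ^ k)) = gridVal v h μ₀ k i := by
  have h2 : (i : ℝ) * (1 / 2 ^ k) * 2 ^ k = i := by field_simp
  rw [scheme, h2, Nat.floor_natCast, sub_self, splitStep_zero]

/-- The scheme starts from `μ₀`. -/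
lemma scheme_zero (v : Ms d → Sp d → Sp d) (h : Ms d → Ms d) (μ₀ : Ms d) (k : ℕ) :
    scheme v h μ₀ k 0 = μ₀ := by
  simpa [gridVal] using scheme_grid v h μ₀ k 0

/-- The defining relation of the scheme, on the closed intervals `[iΔt, (i+1)Δt]`. -/
lemma scheme_eq (v : Ms d → Sp d → Sp d) (h : Ms d → Ms d) (μ₀ : Ms d) (k i : ℕ) (t : ℝ)
    (ht : t ∈ Icc ((i : ℝ) * (1 / 2 ^ k)) ((i + 1) * (1 / 2 ^ k))) :
    scheme v h μ₀ k t =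
      (scheme v h μ₀ k (i * (1 / 2 ^ k))).map
          (flow (v (scheme v h μ₀ k (i * (1 / 2 ^ k)))) (t - i * (1 / 2 ^ k))) +
        (t - i * (1 / 2 ^ k)) • h (scheme v h μ₀ k (i * (1 / 2 ^ k))) := by
  rw [scheme_grid]
  change _ = splitStep v h (t - i * (1 / 2 ^ k)) (gridVal v h μ₀ k i)
  rcases ht.2.eq_or_lt with he | hlt
  · have h1 : t = ((i + 1 : ℕ) : ℝ) * (1 / 2 ^ k) := by push_cast; exact he
    rw [h1, scheme_grid, gridVal]
    congr 1
    push_cast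
    ring
  · have h2 : ⌊t * 2 ^ k⌋₊ = i := by
      have hp : (0 : ℝ) < 2 ^ k := by positivity
      have hge : (i : ℝ) ≤ t * 2 ^ k := by
        have := mul_le_mul_of_nonneg_right ht.1 hp.le
        rwa [mul_assoc, one_div, inv_mul_cancel₀ hp.ne', mul_one] at this
      have hl : t * 2 ^ k < (i : ℝ) + 1 := by
        have := mul_lt_mul_of_pos_right hlt hp
        rwa [mul_assoc, one_div, inv_mul_cancel₀ hp.ne', mul_one] at this
      exact (Nat.floor_eq_iff (le_trans (Nat.cast_nonneg i) hge)).2 ⟨hge, hl⟩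
    rw [scheme, h2]

end SignedTransport

end

open MeasureTheory Filter Set
open scoped ENNReal NNReal Topology

noncomputable section

namespace SignedTransport

variable {d : ℕ}

/-! ### Total variation and mass -/

/-! The proof is the classical argument for one-step methods, stability plus consistency, carried
out in `gNorm`. The norm must first be made usable. It is defined through the Jordan parts, which
behave badly under sums and images. `gNorm_le_of_hasPlan` and `exists_hasPlan_gNorm` identify it
with the infimum of `a |σ - (μ' - ν')| + b c` over all pairs `μ'`, `ν'` joined by a plan of cost
`c`. The upper bound rests on the cancellation property `gDist_le_of_add_eq_add`. Subadditivity,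
homogeneity and the effect of push-forwards then follow by manipulating plans. For the scheme, one
step of length `s` expands distances by at most `exp (A s)` (stability), and two half steps differ
from a full step by `O(s²)` (consistency). Over at most `2^k` steps a discrete Gronwall argument
gives a distance `O(2⁻ᵏ)` between levels `k` and `k + 1` at the coarse grid points. Uniform
Lipschitz continuity in time extends this to `[0,1]`, and the geometric series gives the Cauchy
property. The constants are uniform because the mass stays below `|μ₀| + P`. -/

lemma totalVariation_le {α : Type*} [MeasurableSpace α] {σ : SignedMeasure α} {μ ν : Measure α}
    [IsFiniteMeasure μ] [IsFiniteMeasure ν] (h : σ = μ.toSignedMeasure - ν.toSignedMeasure) :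
    σ.totalVariation ≤ μ + ν := by
  -- Minimality of the Jordan decomposition: with `i` the Hahn set, the positive part of `s` is `μ
  -- (i ∩ s) - ν (i ∩ s) ≤ μ s`, and symmetrically on the complement.
  obtain ⟨i, hi, hi0, hi1, hp, hn⟩ := σ.toJordanDecomposition_spec
  have key : ∀ s, MeasurableSet s → σ s = μ.real s - ν.real s := fun s hs => by
    rw [h, Measure.toSignedMeasure_sub_apply hs]
  refine Measure.le_iff.2 fun s hs => ?_
  rw [SignedMeasure.totalVariation, hp, hn, Measure.add_apply, Measure.add_apply]
  refine add_le_add ?_ ?_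
  · rw [← ENNReal.toReal_le_toReal (measure_ne_top _ _) (measure_ne_top _ _)]
    change (Measure.real _ _) ≤ Measure.real _ _
    rw [SignedMeasure.toMeasureOfZeroLE_real_apply _ hi0 hi hs, key _ (hi.inter hs)]
    have h1 : μ.real (i ∩ s) ≤ μ.real s := measureReal_mono inter_subset_right
    have h2 : 0 ≤ ν.real (i ∩ s) := measureReal_nonneg
    linarith
  · rw [← ENNReal.toReal_le_toReal (measure_ne_top _ _) (measure_ne_top _ _)]
    change (Measure.real _ _) ≤ Measure.real _ _
    rw [SignedMeasure.toMeasureOfLEZero_real_apply _ hi1 hi.compl hs, key _ (hi.compl.inter hs)]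
    have h1 : ν.real (iᶜ ∩ s) ≤ ν.real s := measureReal_mono inter_subset_right
    have h2 : 0 ≤ μ.real (iᶜ ∩ s) := measureReal_nonneg
    linarith

/-- The positive part of the Jordan decomposition, as a finite measure. -/
def pos (σ : Ms d) : FiniteMeasure (Sp d) := ⟨σ.toJordanDecomposition.posPart, inferInstance⟩

/-- The negative part of the Jordan decomposition, as a finite measure. -/
def neg (σ : Ms d) : FiniteMeasure (Sp d) := ⟨σ.toJordanDecomposition.negPart, inferInstance⟩

/-- A finite measure as a signed measure. -/
def sgn (μ : FiniteMeasure (Sp d)) : Ms d := (μ : Measure (Sp d)).toSignedMeasure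

lemma sgn_pos_sub_sgn_neg (σ : Ms d) : sgn (pos σ) - sgn (neg σ) = σ :=
  σ.toSignedMeasure_toJordanDecomposition

lemma sgn_add (μ ν : FiniteMeasure (Sp d)) : sgn (μ + ν) = sgn μ + sgn ν :=
  Measure.toSignedMeasure_add _ _

lemma sgn_smul (c : ℝ≥0) (μ : FiniteMeasure (Sp d)) : sgn (c • μ) = (c : ℝ) • sgn μ :=
  Measure.toSignedMeasure_smul _ _

lemma smul_sub_signed (c : ℝ) (σ τ : Ms d) : c • (σ - τ) = c • σ - c • τ := by
  ext s _
  exact mul_sub c (σ s) (τ s)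

lemma sgn_zero : sgn (0 : FiniteMeasure (Sp d)) = 0 := Measure.toSignedMeasure_zero

lemma sgn_injective : Function.Injective (sgn (d := d)) := fun _ _ h =>
  FiniteMeasure.toMeasure_injective (Measure.toSignedMeasure_eq_toSignedMeasure_iff.1 h)

lemma map_sgn (μ : FiniteMeasure (Sp d)) {f : Sp d → Sp d} (hf : Measurable f) :
    VectorMeasure.map (sgn μ) f = sgn (μ.map f) := by
  ext s hs
  rw [VectorMeasure.map_apply _ hf hs, sgn, sgn, Measure.toSignedMeasure_apply_measurable hs,
    Measure.toSignedMeasure_apply_measurable (hf hs), FiniteMeasure.toMeasure_map,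
    map_measureReal_apply hf hs]

lemma map_sub (σ τ : Ms d) (f : Sp d → Sp d) : (σ - τ).map f = σ.map f - τ.map f := by
  rw [eq_sub_iff_add_eq, ← VectorMeasure.map_add, sub_add_cancel]

lemma mass_nonneg (σ : Ms d) : 0 ≤ mass σ := ENNReal.toReal_nonneg

lemma mass_eq (σ : Ms d) : mass σ = (pos σ).mass + (neg σ).mass := by
  rw [mass, SignedMeasure.totalVariation, Measure.add_apply,
    ENNReal.toReal_add (measure_ne_top _ _) (measure_ne_top _ _)]
  rfl

/-- Bounds on the mass of sums, multiples and images reduce to this one, by writing the result as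
some difference of positive measures, not necessarily its Jordan decomposition. -/
lemma mass_sgn_sub_le (μ ν : FiniteMeasure (Sp d)) : mass (sgn μ - sgn ν) ≤ μ.mass + ν.mass := by
  have h := totalVariation_le (σ := sgn μ - sgn ν) rfl univ
  rw [mass]
  refine (ENNReal.toReal_mono (measure_ne_top _ _) h).trans_eq ?_
  rw [Measure.add_apply, ENNReal.toReal_add (measure_ne_top _ _) (measure_ne_top _ _)]
  rfl

lemma mass_neg (σ : Ms d) : mass (-σ) = mass σ := by
  rw [mass, SignedMeasure.totalVariation_neg, mass]

lemma mass_sub_comm (σ τ : Ms d) : mass (σ - τ) = mass (τ - σ) := by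
  rw [← mass_neg, neg_sub]

lemma mass_zero : mass (0 : Ms d) = 0 := by
  simp [mass, SignedMeasure.totalVariation_zero]

lemma mass_add_le (σ τ : Ms d) : mass (σ + τ) ≤ mass σ + mass τ := by
  have h : σ + τ = sgn (pos σ + pos τ) - sgn (neg σ + neg τ) := by
    rw [sgn_add, sgn_add]
    nth_rw 1 [← sgn_pos_sub_sgn_neg σ, ← sgn_pos_sub_sgn_neg τ]
    abel
  rw [h, mass_eq σ, mass_eq τ]
  refine (mass_sgn_sub_le _ _).trans_eq ?_
  simp only [FiniteMeasure.mass, FiniteMeasure.coeFn_add, Pi.add_apply, NNReal.coe_add]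
  ring

lemma mass_smul_le {c : ℝ} (hc : 0 ≤ c) (σ : Ms d) : mass (c • σ) ≤ c * mass σ := by
  lift c to ℝ≥0 using hc
  have h : (c : ℝ) • σ = sgn (c • pos σ) - sgn (c • neg σ) := by
    rw [sgn_smul, sgn_smul, ← smul_sub_signed, sgn_pos_sub_sgn_neg]
  rw [h, mass_eq σ]
  refine (mass_sgn_sub_le _ _).trans_eq ?_
  simp only [FiniteMeasure.mass, FiniteMeasure.coeFn_smul, Pi.smul_apply, smul_eq_mul,
    NNReal.coe_mul]
  ring

lemma map_eq_sgn_sub (σ : Ms d) {f : Sp d → Sp d} (hf : Measurable f) :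
    σ.map f = sgn ((pos σ).map f) - sgn ((neg σ).map f) := by
  rw [← map_sgn _ hf, ← map_sgn _ hf, ← map_sub, sgn_pos_sub_sgn_neg]

lemma mass_map_finite (μ : FiniteMeasure (Sp d)) {f : Sp d → Sp d} (hf : Measurable f) :
    (μ.map f).mass = μ.mass := by
  rw [FiniteMeasure.mass, FiniteMeasure.map_apply _ hf MeasurableSet.univ]
  rfl

lemma mass_map_le (σ : Ms d) {f : Sp d → Sp d} (hf : Measurable f) :
    mass (σ.map f) ≤ mass σ := by
  rw [map_eq_sgn_sub σ hf, mass_eq σ]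
  refine (mass_sgn_sub_le _ _).trans_eq ?_
  rw [mass_map_finite _ hf, mass_map_finite _ hf]

/-! ### Transference plans of bounded cost -/

/-- There is a transference plan from `μ` to `ν` of cost at most `c`. -/
def HasPlan (μ ν : FiniteMeasure (Sp d)) (c : ℝ) : Prop :=
  ∃ π ∈ Plans (μ : Measure (Sp d)) ν, ∫⁻ z, edist z.1 z.2 ∂π ≤ ENNReal.ofReal c

namespace HasPlan

variable {μ ν μ' ν' κ : FiniteMeasure (Sp d)} {c c' : ℝ}

lemma mass_eq (h : HasPlan μ ν c) : μ.mass = ν.mass := by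
  obtain ⟨π, ⟨h1, h2⟩, -⟩ := h
  have e1 := congrArg (fun m : Measure (Sp d) => m univ) h1
  have e2 := congrArg (fun m : Measure (Sp d) => m univ) h2
  simp only [Measure.map_apply measurable_fst MeasurableSet.univ,
    Measure.map_apply measurable_snd MeasurableSet.univ, preimage_univ] at e1 e2
  have : (μ.mass : ℝ≥0∞) = ν.mass := by
    rw [FiniteMeasure.ennreal_mass, FiniteMeasure.ennreal_mass, ← e1, ← e2]
  exact_mod_cast this

lemma of_map (μ : FiniteMeasure (Sp d)) {f g : Sp d → Sp d} (hf : Measurable f)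
    (hg : Measurable g) {D : ℝ} (hD : ∀ x, dist (f x) (g x) ≤ D) :
    HasPlan (μ.map f) (μ.map g) (D * μ.mass) := by
  refine ⟨(μ : Measure (Sp d)).map (fun x => (f x, g x)), ⟨?_, ?_⟩, ?_⟩
  · rw [Measure.map_map measurable_fst (hf.prodMk hg)]; rfl
  · rw [Measure.map_map measurable_snd (hf.prodMk hg)]; rfl
  · rw [lintegral_map (measurable_fst.edist measurable_snd) (hf.prodMk hg)]
    calc ∫⁻ x, edist (f x) (g x) ∂(μ : Measure (Sp d))
        ≤ ∫⁻ _, ENNReal.ofReal D ∂(μ : Measure (Sp d)) := by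
          refine lintegral_mono fun x => ?_
          rw [edist_dist]
          exact ENNReal.ofReal_le_ofReal (hD x)
      _ = ENNReal.ofReal (D * μ.mass) := by
          rw [lintegral_const, ENNReal.ofReal_mul' (NNReal.coe_nonneg _), ENNReal.ofReal_coe_nnreal,
            FiniteMeasure.ennreal_mass]

lemma refl (μ : FiniteMeasure (Sp d)) : HasPlan μ μ 0 := by
  have h := of_map μ measurable_id measurable_id (D := 0) (fun x => (dist_self _).le)
  have e : μ.map id = μ := FiniteMeasure.toMeasure_injective (by simp)
  simpa [e] using h

lemma map (h : HasPlan μ ν c) {f : Sp d → Sp d} {C : ℝ≥0} (hf : LipschitzWith C f) :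
    HasPlan (μ.map f) (ν.map f) (C * c) := by
  obtain ⟨π, ⟨h1, h2⟩, h3⟩ := h
  have hm := hf.continuous.measurable
  refine ⟨π.map (Prod.map f f), ⟨?_, ?_⟩, ?_⟩
  · rw [Measure.map_map measurable_fst (hm.prodMap hm), FiniteMeasure.toMeasure_map, ← h1,
      Measure.map_map hm measurable_fst]
    rfl
  · rw [Measure.map_map measurable_snd (hm.prodMap hm), FiniteMeasure.toMeasure_map, ← h2,
      Measure.map_map hm measurable_snd]
    rfl
  · rw [lintegral_map (measurable_fst.edist measurable_snd) (hm.prodMap hm),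
      ENNReal.ofReal_mul (NNReal.coe_nonneg C), ENNReal.ofReal_coe_nnreal]
    refine le_trans ?_ (mul_le_mul_right h3 (C : ℝ≥0∞))
    rw [← lintegral_const_mul _ (measurable_fst.edist measurable_snd)]
    exact lintegral_mono fun z => hf z.1 z.2

lemma add (h : HasPlan μ ν c) (h' : HasPlan μ' ν' c') (hc : 0 ≤ c) (hc' : 0 ≤ c') :
    HasPlan (μ + μ') (ν + ν') (c + c') := by
  obtain ⟨π, ⟨h1, h2⟩, h3⟩ := h
  obtain ⟨π', ⟨h1', h2'⟩, h3'⟩ := h'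
  refine ⟨π + π', ⟨?_, ?_⟩, ?_⟩
  · rw [Measure.map_add _ _ measurable_fst, h1, h1']; rfl
  · rw [Measure.map_add _ _ measurable_snd, h2, h2']; rfl
  · rw [lintegral_add_measure, ENNReal.ofReal_add hc hc']
    exact add_le_add h3 h3'

lemma smul (h : HasPlan μ ν c) (r : ℝ≥0) : HasPlan (r • μ) (r • ν) (r * c) := by
  obtain ⟨π, ⟨h1, h2⟩, h3⟩ := h
  refine ⟨r • π, ⟨?_, ?_⟩, ?_⟩
  · rw [Measure.map_smul, h1]; rfl
  · rw [Measure.map_smul, h2]; rfl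
  · rw [lintegral_smul_measure, ENNReal.ofReal_mul (NNReal.coe_nonneg r), ENNReal.ofReal_coe_nnreal]
    exact mul_le_mul_right h3 (r : ℝ≥0∞)

lemma symm (h : HasPlan μ ν c) : HasPlan ν μ c := by
  obtain ⟨π, ⟨h1, h2⟩, h3⟩ := h
  refine ⟨π.map Prod.swap, ⟨?_, ?_⟩, ?_⟩
  · rw [Measure.map_map measurable_fst measurable_swap, ← h2]; rfl
  · rw [Measure.map_map measurable_snd measurable_swap, ← h1]; rfl
  · rw [lintegral_map (measurable_fst.edist measurable_snd) measurable_swap]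
    refine le_trans (lintegral_mono fun z => ?_) h3
    rw [edist_comm]
    rfl

open ProbabilityTheory in
/-- Gluing of transference plans, by disintegration along the intermediate measure. -/
lemma trans (h : HasPlan μ κ c) (h' : HasPlan κ ν c') (hc : 0 ≤ c) (hc' : 0 ≤ c') :
    HasPlan μ ν (c + c') := by
  -- The first plan is reversed so that both plans have first marginal `κ` and can be disintegrated
  -- over it.
  obtain ⟨π, ⟨h1, h2⟩, h3⟩ := h.symm
  obtain ⟨π', ⟨h1', h2'⟩, h3'⟩ := h'
  have : IsFiniteMeasure π := by
    have : IsFiniteMeasure (π.map Prod.fst) := by rw [h1]; infer_instance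
    exact Measure.isFiniteMeasure_of_map measurable_fst.aemeasurable
  have : IsFiniteMeasure π' := by
    have : IsFiniteMeasure (π'.map Prod.fst) := by rw [h1']; infer_instance
    exact Measure.isFiniteMeasure_of_map measurable_fst.aemeasurable
  have d1 : (κ : Measure (Sp d)) ⊗ₘ π.condKernel = π := by
    conv_rhs => rw [← π.disintegrate π.condKernel]
    rw [Measure.fst, h1]
  have d2 : (κ : Measure (Sp d)) ⊗ₘ π'.condKernel = π' := by
    conv_rhs => rw [← π'.disintegrate π'.condKernel]
    rw [Measure.fst, h1']
  -- Given the intermediate point, the two endpoints are drawn independently; `γ` has both plans as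
  -- marginals.
  set γ := (κ : Measure (Sp d)) ⊗ₘ (π.condKernel ×ₖ π'.condKernel) with hγ
  have g1 : γ.map (Prod.map id Prod.fst) = π := by
    rw [hγ, ← Measure.compProd_map measurable_fst, ← Kernel.fst_eq, Kernel.fst_prod, d1]
  have g2 : γ.map (Prod.map id Prod.snd) = π' := by
    rw [hγ, ← Measure.compProd_map measurable_snd, ← Kernel.snd_eq, Kernel.snd_prod, d2]
  have m1 : Measurable (Prod.map id Prod.fst : Sp d × Sp d × Sp d → Sp d × Sp d) := by fun_prop
  have m2 : Measurable (Prod.map id Prod.snd : Sp d × Sp d × Sp d → Sp d × Sp d) := by fun_prop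
  refine ⟨γ.map Prod.snd, ⟨?_, ?_⟩, ?_⟩
  · rw [← h2, ← g1, Measure.map_map measurable_fst measurable_snd,
      Measure.map_map measurable_snd m1]
    rfl
  · rw [← h2', ← g2, Measure.map_map measurable_snd measurable_snd,
      Measure.map_map measurable_snd m2]
    rfl
  · rw [← g1, lintegral_map (measurable_fst.edist measurable_snd) m1] at h3
    rw [← g2, lintegral_map (measurable_fst.edist measurable_snd) m2] at h3'
    rw [lintegral_map (measurable_fst.edist measurable_snd) measurable_snd,
      ENNReal.ofReal_add hc hc']
    refine le_trans ?_ (add_le_add h3 h3')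
    rw [← lintegral_add_left (by exact (measurable_fst.edist measurable_snd).comp m1)]
    refine lintegral_mono fun z => ?_
    exact (edist_triangle _ z.1 _).trans_eq (by rw [edist_comm z.2.1]; rfl)

end HasPlan

/-! ### The generalized Wasserstein distance between positive measures -/

lemma mass_sgn_le (μ : FiniteMeasure (Sp d)) : mass (sgn μ) ≤ μ.mass := by
  simpa [sgn_zero] using mass_sgn_sub_le μ 0

lemma mass_sub_le (σ τ : Ms d) : mass (σ - τ) ≤ mass σ + mass τ := by
  rw [sub_eq_add_neg, ← mass_neg τ]
  exact mass_add_le _ _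

lemma mass_sub_le_mass_sub_add (σ τ ρ : Ms d) : mass (σ - ρ) ≤ mass (σ - τ) + mass (τ - ρ) := by
  rw [← sub_add_sub_cancel σ τ ρ]
  exact mass_add_le _ _

/-- The generalized Wasserstein distance as a real number. -/
def gDist (a b : ℝ) (μ ν : FiniteMeasure (Sp d)) : ℝ :=
  (genW1 a b (μ : Measure (Sp d)) (ν : Measure (Sp d))).toReal

variable {a b : ℝ} {μ ν κ μ' ν' : FiniteMeasure (Sp d)} {c : ℝ}

lemma gDist_le (ha : 0 < a) (hb : 0 < b) (h : HasPlan μ' ν' c) (hc : 0 ≤ c) :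
    gDist a b μ ν ≤ a * (mass (sgn μ - sgn μ') + mass (sgn ν - sgn ν')) + b * c := by
  have h0 : 0 ≤ a * (mass (sgn μ - sgn μ') + mass (sgn ν - sgn ν')) :=
    mul_nonneg ha.le (add_nonneg (mass_nonneg _) (mass_nonneg _))
  refine ENNReal.toReal_le_of_le_ofReal (by positivity) ?_
  refine (iInf_le_of_le μ' (iInf_le_of_le ν' (iInf_le_of_le h.mass_eq le_rfl))).trans ?_
  rw [ENNReal.ofReal_add h0 (by positivity), ENNReal.ofReal_mul hb.le]
  refine add_le_add le_rfl (mul_le_mul_right ?_ _)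
  obtain ⟨π, hπ, hle⟩ := h
  exact (iInf₂_le π hπ).trans hle

lemma exists_hasPlan_lt (hb : 0 < b) {ε : ℝ} (hε : 0 < ε) (μ ν : FiniteMeasure (Sp d)) :
    ∃ (μ' ν' : FiniteMeasure (Sp d)) (c : ℝ), 0 ≤ c ∧ HasPlan μ' ν' c ∧
      a * (mass (sgn μ - sgn μ') + mass (sgn ν - sgn ν')) + b * c ≤ gDist a b μ ν + ε := by
  have hlt : genW1 a b (μ : Measure (Sp d)) (ν : Measure (Sp d)) <
      ENNReal.ofReal (gDist a b μ ν + ε) := by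
    rw [ENNReal.lt_ofReal_iff_toReal_lt (genW1_ne_top _ _ _ _)]
    exact lt_add_of_pos_right _ hε
  rw [genW1] at hlt
  simp only [iInf_lt_iff] at hlt
  obtain ⟨μ', ν', -, hlt⟩ := hlt
  change ENNReal.ofReal (a * (mass (sgn μ - sgn μ') + mass (sgn ν - sgn ν'))) + _ < _ at hlt
  set A := a * (mass (sgn μ - sgn μ') + mass (sgn ν - sgn ν'))
  have h1 : ENNReal.ofReal b * W1 (μ' : Measure (Sp d)) ν' <
      ENNReal.ofReal (gDist a b μ ν + ε - A) := by
    -- No sign is assumed on `a` here; when `A < 0`, `ENNReal.ofReal A` is truncated to `0` and the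
    -- bound only improves.
    rcases le_or_gt 0 A with hA | hA
    · rw [ENNReal.ofReal_sub _ hA]
      exact lt_tsub_iff_left.2 hlt
    · rw [ENNReal.ofReal_of_nonpos hA.le, zero_add] at hlt
      exact hlt.trans_le (ENNReal.ofReal_le_ofReal (by linarith))
  have hbpos : ENNReal.ofReal b ≠ 0 := by simpa using hb
  have h2 : W1 (μ' : Measure (Sp d)) ν' < ENNReal.ofReal ((gDist a b μ ν + ε - A) / b) := by
    rw [ENNReal.ofReal_div_of_pos hb, ENNReal.lt_div_iff_mul_lt (Or.inl hbpos)
      (Or.inl ENNReal.ofReal_ne_top), mul_comm]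
    exact h1
  rw [W1] at h2
  simp only [iInf_lt_iff] at h2
  obtain ⟨π, hπ, hlt2⟩ := h2
  have hpos := ENNReal.ofReal_pos.1 (bot_le.trans_lt hlt2)
  -- The cost `c` is chosen to turn the required inequality into an equality.
  refine ⟨μ', ν', _, hpos.le, ⟨π, hπ, hlt2.le⟩, ?_⟩
  rw [mul_div_cancel₀ _ hb.ne']
  linarith

/-- Two near-optimal plans end and start at different measures `κ₁`, `κ₂`. Letting `(κ₁ - κ₂)⁻` stay
put in the first plan and `(κ₁ - κ₂)⁺` in the second makes them composable. The mass so added is at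
most `|κ - κ₁| + |κ - κ₂|`, which the two costs already pay for. -/
lemma gDist_triangle (ha : 0 < a) (hb : 0 < b) (μ κ ν : FiniteMeasure (Sp d)) :
    gDist a b μ ν ≤ gDist a b μ κ + gDist a b κ ν := by
  refine le_of_forall_pos_le_add fun ε hε => ?_
  obtain ⟨μ', κ₁, c₁, hc₁, hp₁, h₁⟩ := exists_hasPlan_lt (a := a) hb (half_pos hε) μ κ
  obtain ⟨κ₂, ν', c₂, hc₂, hp₂, h₂⟩ := exists_hasPlan_lt (a := a) hb (half_pos hε) κ ν
  set τ := sgn κ₁ - sgn κ₂ with hτ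
  have hκ : κ₁ + neg τ = κ₂ + pos τ := by
    refine sgn_injective ?_
    rw [sgn_add, sgn_add]
    have h := sgn_pos_sub_sgn_neg τ
    rw [sub_eq_iff_eq_add] at h
    rw [h, hτ]
    abel
  have p₁ := hp₁.add (HasPlan.refl (neg τ)) hc₁ le_rfl
  have p₂ := hp₂.add (HasPlan.refl (pos τ)) hc₂ le_rfl
  rw [hκ, add_zero] at p₁
  rw [add_zero] at p₂
  have h := gDist_le (μ := μ) (ν := ν) ha hb (p₁.trans p₂ hc₁ hc₂) (add_nonneg hc₁ hc₂)
  have m₁ : mass (sgn μ - sgn (μ' + neg τ)) ≤ mass (sgn μ - sgn μ') + (neg τ).mass := by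
    rw [sgn_add, ← sub_sub]
    exact (mass_sub_le _ _).trans (add_le_add_right (mass_sgn_le _) _)
  have m₂ : mass (sgn ν - sgn (ν' + pos τ)) ≤ mass (sgn ν - sgn ν') + (pos τ).mass := by
    rw [sgn_add, ← sub_sub]
    exact (mass_sub_le _ _).trans (add_le_add_right (mass_sgn_le _) _)
  have m₃ : ((pos τ).mass : ℝ) + (neg τ).mass ≤
      mass (sgn κ - sgn κ₁) + mass (sgn κ - sgn κ₂) := by
    rw [← mass_eq, mass_sub_comm (sgn κ)]
    exact mass_sub_le_mass_sub_add _ _ _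
  nlinarith

lemma gDist_add_right_le (ha : 0 < a) (hb : 0 < b) (μ ν η : FiniteMeasure (Sp d)) :
    gDist a b (μ + η) (ν + η) ≤ gDist a b μ ν := by
  refine le_of_forall_pos_le_add fun ε hε => ?_
  obtain ⟨μ', ν', c, hc, hp, h⟩ := exists_hasPlan_lt (a := a) hb hε μ ν
  have p := hp.add (HasPlan.refl η) hc le_rfl
  rw [add_zero] at p
  have h' := gDist_le (μ := μ + η) (ν := ν + η) ha hb p hc
  rw [sgn_add, sgn_add, sgn_add, sgn_add, add_sub_add_right_eq_sub, add_sub_add_right_eq_sub] at h'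
  exact h'.trans h

lemma gDist_smul_le (ha : 0 < a) (hb : 0 < b) (r : ℝ≥0) (μ ν : FiniteMeasure (Sp d)) :
    gDist a b (r • μ) (r • ν) ≤ r * gDist a b μ ν := by
  refine le_of_forall_pos_le_add fun ε hε => ?_
  -- Dividing by `r + 1` rather than `r` covers `r = 0`.
  have hr : (0 : ℝ) < r + 1 := by positivity
  obtain ⟨μ', ν', c, hc, hp, h⟩ := exists_hasPlan_lt (a := a) hb (div_pos hε hr) μ ν
  have h' := gDist_le (μ := r • μ) (ν := r • ν) ha hb (hp.smul r) (by positivity)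
  rw [sgn_smul, sgn_smul, sgn_smul, sgn_smul, ← smul_sub_signed, ← smul_sub_signed] at h'
  have m₁ := mass_smul_le r.2 (sgn μ - sgn μ')
  have m₂ := mass_smul_le r.2 (sgn ν - sgn ν')
  have h1 : (r : ℝ) * (ε / (r + 1)) ≤ ε := by
    rw [mul_div_assoc', div_le_iff₀ hr]
    nlinarith [r.2]
  have h2 := mul_le_mul_of_nonneg_left h r.2
  have h3 := mul_le_mul_of_nonneg_left (add_le_add m₁ m₂) ha.le
  simp only [NNReal.val_eq_coe] at *
  linarith

lemma gDist_le_mass (ha : 0 < a) (hb : 0 < b) (μ ν : FiniteMeasure (Sp d)) :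
    gDist a b μ ν ≤ a * mass (sgn μ - sgn ν) := by
  have h := gDist_le (μ := μ) (ν := ν) ha hb (HasPlan.refl ν) le_rfl
  simpa [mass_zero] using h

/-- Cancellation for the generalized Wasserstein distance. -/
lemma gDist_le_of_add_eq_add (ha : 0 < a) (hb : 0 < b) {μ ν η θ : FiniteMeasure (Sp d)}
    (h : μ + η = ν + θ) : gDist a b μ ν ≤ gDist a b θ η := by
  -- Since `μ + η = ν + θ`, one copy of `μ` can be traded for `ν` beside the catalyst `η`: it frees
  -- `θ`, which is moved back to `η` at cost `gDist a b θ η`. This is done `n` times with a single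
  -- `η`.
  have chain : ∀ n : ℕ, gDist a b ((n : ℝ≥0) • μ + η) ((n : ℝ≥0) • ν + η) ≤
      n * gDist a b θ η := by
    intro n
    induction n with
    | zero => simpa [mass_zero] using gDist_le_mass ha hb η η
    | succ n ih =>
      refine (gDist_triangle ha hb _ ((n : ℝ≥0) • μ + η + ν) _).trans ?_
      have e1 : ((n + 1 : ℕ) : ℝ≥0) • μ + η = θ + ((n : ℝ≥0) • μ + ν) := by
        rw [Nat.cast_succ, add_smul, one_smul, add_assoc, h]
        abel
      have e2 : (n : ℝ≥0) • μ + η + ν = η + ((n : ℝ≥0) • μ + ν) := by abel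
      have e3 : ((n + 1 : ℕ) : ℝ≥0) • ν + η = (n : ℝ≥0) • ν + η + ν := by
        rw [Nat.cast_succ, add_smul, one_smul]
        abel
      have i1 := gDist_add_right_le ha hb θ η ((n : ℝ≥0) • μ + ν)
      have i2 := gDist_add_right_le ha hb ((n : ℝ≥0) • μ + η) ((n : ℝ≥0) • ν + η) ν
      rw [e1, e3]
      nth_rw 1 [e2]
      push_cast
      linarith
  -- Adding and removing the catalyst costs `2 a |η|`, independently of `n`, so it disappears after
  -- division by `n → ∞`.
  have bound : ∀ n : ℕ, 0 < n →
      n * (gDist a b μ ν - gDist a b θ η) ≤ 2 * (a * mass (sgn η)) := by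
    intro n hn
    have hn' : (n : ℝ≥0) ≠ 0 := by exact_mod_cast hn.ne'
    have h1 := gDist_smul_le ha hb (n : ℝ≥0)⁻¹ ((n : ℝ≥0) • μ) ((n : ℝ≥0) • ν)
    rw [smul_smul, smul_smul, inv_mul_cancel₀ hn', one_smul, one_smul] at h1
    have h2 := gDist_triangle ha hb ((n : ℝ≥0) • μ) ((n : ℝ≥0) • μ + η) ((n : ℝ≥0) • ν)
    have h3 := gDist_triangle ha hb ((n : ℝ≥0) • μ + η) ((n : ℝ≥0) • ν + η) ((n : ℝ≥0) • ν)
    have h4 := gDist_le_mass ha hb ((n : ℝ≥0) • μ) ((n : ℝ≥0) • μ + η)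
    have h5 := gDist_le_mass ha hb ((n : ℝ≥0) • ν + η) ((n : ℝ≥0) • ν)
    rw [sgn_add, sub_add_cancel_left, mass_neg] at h4
    rw [sgn_add, add_sub_cancel_left] at h5
    have h6 := chain n
    have hnR : (0 : ℝ) < n := by exact_mod_cast hn
    push_cast at h1
    rw [← div_eq_inv_mul, le_div_iff₀ hnR] at h1
    linarith
  by_contra! hlt
  obtain ⟨n, hn⟩ := exists_nat_gt (2 * (a * mass (sgn η)) / (gDist a b μ ν - gDist a b θ η))
  have hpos : 0 < gDist a b μ ν - gDist a b θ η := by linarith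
  rw [div_lt_iff₀ hpos] at hn
  have hm := mul_nonneg ha.le (mass_nonneg (sgn η))
  have hn0 : 0 < n := by
    rcases Nat.eq_zero_or_pos n with rfl | h0
    · simp at hn; linarith
    · exact h0
  linarith [bound n hn0]

/-! ### The generalized Wasserstein norm -/

variable {σ τ : Ms d}

lemma gNorm_nonneg (a b : ℝ) (σ : Ms d) : 0 ≤ gNorm a b σ := ENNReal.toReal_nonneg

/-- With `τ = σ - (μ' - ν')`, the measures `μ' + τ⁺` and `ν' + τ⁻` also have difference `σ`, so
cancellation allows them to replace the Jordan parts. Deleting `τ⁺` and `τ⁻` costs `a |τ|`, and the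
plan transports the rest. -/
lemma gNorm_le_of_hasPlan (ha : 0 < a) (hb : 0 < b) (h : HasPlan μ' ν' c) (hc : 0 ≤ c) :
    gNorm a b σ ≤ a * mass (σ - (sgn μ' - sgn ν')) + b * c := by
  set τ := σ - (sgn μ' - sgn ν') with hτ
  have e : pos σ + (ν' + neg τ) = neg σ + (μ' + pos τ) := by
    refine sgn_injective ?_
    rw [sgn_add, sgn_add, sgn_add, sgn_add]
    have h1 := sgn_pos_sub_sgn_neg τ
    have h2 := sgn_pos_sub_sgn_neg σ
    rw [sub_eq_iff_eq_add] at h1 h2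
    rw [h1, h2, hτ]
    abel
  refine (gDist_le_of_add_eq_add ha hb e).trans
    ((gDist_le ha hb h hc).trans ?_)
  rw [sgn_add, sgn_add, add_sub_cancel_left, add_sub_cancel_left, mass_eq τ]
  gcongr <;> exact mass_sgn_le _

lemma exists_hasPlan_gNorm (ha : 0 < a) (hb : 0 < b) {ε : ℝ} (hε : 0 < ε) (σ : Ms d) :
    ∃ (μ' ν' : FiniteMeasure (Sp d)) (c : ℝ), 0 ≤ c ∧ HasPlan μ' ν' c ∧
      a * mass (σ - (sgn μ' - sgn ν')) + b * c ≤ gNorm a b σ + ε := by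
  obtain ⟨μ', ν', c, hc, hp, h⟩ := exists_hasPlan_lt (a := a) hb hε (pos σ) (neg σ)
  refine ⟨μ', ν', c, hc, hp, le_trans ?_ h⟩
  have e : σ - (sgn μ' - sgn ν') = (sgn (pos σ) - sgn μ') - (sgn (neg σ) - sgn ν') := by
    nth_rw 1 [← sgn_pos_sub_sgn_neg σ]
    abel
  rw [e]
  gcongr
  exact mass_sub_le _ _

lemma gNorm_add_le (ha : 0 < a) (hb : 0 < b) (σ τ : Ms d) :
    gNorm a b (σ + τ) ≤ gNorm a b σ + gNorm a b τ := by
  refine le_of_forall_pos_le_add fun ε hε => ?_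
  obtain ⟨μ₁, ν₁, c₁, hc₁, hp₁, h₁⟩ := exists_hasPlan_gNorm ha hb (half_pos hε) σ
  obtain ⟨μ₂, ν₂, c₂, hc₂, hp₂, h₂⟩ := exists_hasPlan_gNorm ha hb (half_pos hε) τ
  have h := gNorm_le_of_hasPlan (σ := σ + τ) ha hb (hp₁.add hp₂ hc₁ hc₂) (add_nonneg hc₁ hc₂)
  have e : σ + τ - (sgn (μ₁ + μ₂) - sgn (ν₁ + ν₂)) =
      (σ - (sgn μ₁ - sgn ν₁)) + (τ - (sgn μ₂ - sgn ν₂)) := by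
    rw [sgn_add, sgn_add]
    abel
  rw [e] at h
  have m := mul_le_mul_of_nonneg_left
    (mass_add_le (σ - (sgn μ₁ - sgn ν₁)) (τ - (sgn μ₂ - sgn ν₂))) ha.le
  linarith

lemma gNorm_neg (ha : 0 < a) (hb : 0 < b) (σ : Ms d) : gNorm a b (-σ) = gNorm a b σ := by
  have key : ∀ σ : Ms d, gNorm a b (-σ) ≤ gNorm a b σ := fun σ => by
    refine le_of_forall_pos_le_add fun ε hε => ?_
    obtain ⟨μ', ν', c, hc, hp, h⟩ := exists_hasPlan_gNorm ha hb hε σ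
    refine (gNorm_le_of_hasPlan ha hb hp.symm hc).trans (le_trans (le_of_eq ?_) h)
    rw [← mass_neg]
    congr 3
    abel
  exact le_antisymm (key σ) (by simpa using key (-σ))

lemma gNorm_sub_comm (ha : 0 < a) (hb : 0 < b) (σ τ : Ms d) :
    gNorm a b (σ - τ) = gNorm a b (τ - σ) := by
  rw [← gNorm_neg ha hb, neg_sub]

lemma gNorm_sub_le_add (ha : 0 < a) (hb : 0 < b) (σ τ ρ : Ms d) :
    gNorm a b (σ - ρ) ≤ gNorm a b (σ - τ) + gNorm a b (τ - ρ) := by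
  rw [← sub_add_sub_cancel σ τ ρ]
  exact gNorm_add_le ha hb _ _

lemma gNorm_le_mass (ha : 0 < a) (hb : 0 < b) (σ : Ms d) : gNorm a b σ ≤ a * mass σ := by
  have h := gNorm_le_of_hasPlan (σ := σ) ha hb (HasPlan.refl 0) le_rfl
  simpa using h

lemma gNorm_zero (ha : 0 < a) (hb : 0 < b) : gNorm a b (0 : Ms d) = 0 :=
  le_antisymm (by simpa [mass_zero] using gNorm_le_mass ha hb (0 : Ms d)) (gNorm_nonneg _ _ _)

lemma gNorm_smul_le (ha : 0 < a) (hb : 0 < b) {r : ℝ} (hr : 0 ≤ r) (σ : Ms d) :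
    gNorm a b (r • σ) ≤ r * gNorm a b σ := by
  lift r to ℝ≥0 using hr
  refine le_of_forall_pos_le_add fun ε hε => ?_
  have hr : (0 : ℝ) < r + 1 := by positivity
  obtain ⟨μ', ν', c, hc, hp, h⟩ := exists_hasPlan_gNorm ha hb (div_pos hε hr) σ
  have h' := gNorm_le_of_hasPlan (σ := (r : ℝ) • σ) ha hb (hp.smul r) (by positivity)
  rw [sgn_smul, sgn_smul, ← smul_sub_signed, ← smul_sub_signed] at h'
  have m := mul_le_mul_of_nonneg_left
    (mass_smul_le r.coe_nonneg (σ - (sgn μ' - sgn ν'))) ha.le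
  have h1 : (r : ℝ) * (ε / (r + 1)) ≤ ε := by
    rw [mul_div_assoc', div_le_iff₀ hr]
    nlinarith [r.coe_nonneg]
  have h2 := mul_le_mul_of_nonneg_left h r.coe_nonneg
  linarith

/-- Pushing a plan forward multiplies its cost by `C`, while the mass term merely does not grow; `1
≤ C` lets one factor cover both. -/
lemma gNorm_map_le (ha : 0 < a) (hb : 0 < b) {f : Sp d → Sp d} {C : ℝ≥0} (hC : 1 ≤ C)
    (hf : LipschitzWith C f) (σ : Ms d) : gNorm a b (σ.map f) ≤ C * gNorm a b σ := by
  have hm := hf.continuous.measurable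
  refine le_of_forall_pos_le_add fun ε hε => ?_
  have hC0 : (0 : ℝ) < C := lt_of_lt_of_le one_pos hC
  obtain ⟨μ', ν', c, hc, hp, h⟩ := exists_hasPlan_gNorm ha hb (div_pos hε hC0) σ
  have h' := gNorm_le_of_hasPlan (σ := σ.map f) ha hb (hp.map hf) (by positivity)
  rw [← map_sgn _ hm, ← map_sgn _ hm, ← map_sub, ← map_sub] at h'
  have m := mul_le_mul_of_nonneg_left (mass_map_le (σ - (sgn μ' - sgn ν')) hm) ha.le
  have h2 := mul_le_mul_of_nonneg_left h hC0.le
  rw [mul_add, mul_add, mul_div_cancel₀ _ hC0.ne'] at h2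
  have h3 : a * mass (σ - (sgn μ' - sgn ν')) ≤ C * (a * mass (σ - (sgn μ' - sgn ν'))) :=
    le_mul_of_one_le_left (mul_nonneg ha.le (mass_nonneg _)) hC
  linarith

/-- Regrouped as `(f#σ⁺ + g#σ⁻) - (g#σ⁺ + f#σ⁻)`, the difference is pure transport along `x ↦ (f x,
g x)`, with no mass created or removed. -/
lemma gNorm_map_sub_map_le (ha : 0 < a) (hb : 0 < b) {f g : Sp d → Sp d} (hf : Measurable f)
    (hg : Measurable g) {D : ℝ} (hD : ∀ x, dist (f x) (g x) ≤ D) (σ : Ms d) :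
    gNorm a b (σ.map f - σ.map g) ≤ b * (D * mass σ) := by
  have hD0 : 0 ≤ D := dist_nonneg.trans (hD 0)
  have p := (HasPlan.of_map (pos σ) hf hg hD).add (HasPlan.of_map (neg σ) hf hg hD).symm
    (by positivity) (by positivity)
  have h := gNorm_le_of_hasPlan (σ := σ.map f - σ.map g) ha hb p (by positivity)
  have e : σ.map f - σ.map g - (sgn ((pos σ).map f + (neg σ).map g) -
      sgn ((pos σ).map g + (neg σ).map f)) = 0 := by
    rw [map_eq_sgn_sub σ hf, map_eq_sgn_sub σ hg, sgn_add, sgn_add]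
    abel
  rw [e, mass_zero, mul_zero, zero_add, ← mul_add, ← mass_eq] at h
  exact h

/-! ### Estimates for the flow -/

section Flow

variable {w u : Sp d → Sp d} {C B C' B' : ℝ≥0}

lemma flow_continuous (hw : LipschitzWith C w) (hB : ∀ x, ‖w x‖ ≤ B) (x : Sp d) :
    Continuous fun s => flow w s x :=
  continuous_iff_continuousAt.2 fun t => ((flow_isFlow hw hB x).2 t).continuousAt

lemma flow_lipschitz (hw : LipschitzWith C w) (hB : ∀ x, ‖w x‖ ≤ B) {s : ℝ} (hs : 0 ≤ s) :
    LipschitzWith (Real.exp (C * s)).toNNReal (flow w s) := by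
  refine LipschitzWith.of_dist_le_mul fun x y => ?_
  have hf := flow_isFlow hw hB
  have h := dist_le_of_trajectories_ODE (v := fun _ => w) (K := C) (a := 0) (b := s)
    (f := fun t => flow w t x) (g := fun t => flow w t y) (δ := dist x y) (fun _ => hw)
    (flow_continuous hw hB x).continuousOn (fun t _ => ((hf x).2 t).hasDerivWithinAt)
    (flow_continuous hw hB y).continuousOn (fun t _ => ((hf y).2 t).hasDerivWithinAt)
    (by simp [flow_zero]) s ⟨hs, le_rfl⟩
  rw [sub_zero] at h
  rw [Real.coe_toNNReal _ (Real.exp_pos _).le, mul_comm]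
  exact h

lemma flow_measurable (hw : LipschitzWith C w) (hB : ∀ x, ‖w x‖ ≤ B) {s : ℝ} (hs : 0 ≤ s) :
    Measurable (flow w s) :=
  (flow_lipschitz hw hB hs).continuous.measurable

lemma flow_dist_flow_le (hw : LipschitzWith C w) (hB : ∀ x, ‖w x‖ ≤ B) (x : Sp d) (r s : ℝ) :
    dist (flow w r x) (flow w s x) ≤ B * |r - s| := by
  have h := Convex.norm_image_sub_le_of_norm_hasDerivWithin_le (s := univ)
    (f := fun t => flow w t x) (f' := fun t => w (flow w t x)) (C := B) (x := s) (y := r)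
    (fun t _ => ((flow_isFlow hw hB x).2 t).hasDerivWithinAt) (fun t _ => hB _) convex_univ
    (mem_univ _) (mem_univ _)
  rwa [dist_eq_norm, ← Real.norm_eq_abs]

lemma norm_flow_le (hw : LipschitzWith C w) (hB : ∀ x, ‖w x‖ ≤ B) (x : Sp d) {s : ℝ}
    (hs : 0 ≤ s) : ‖flow w s x‖ ≤ ‖x‖ + s * B := by
  have h := flow_dist_flow_le hw hB x s 0
  rw [flow_zero, sub_zero, abs_of_nonneg hs, dist_eq_norm, id] at h
  have := norm_le_norm_add_norm_sub' (flow w s x) x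
  linarith

lemma flow_add (hw : LipschitzWith C w) (hB : ∀ x, ‖w x‖ ≤ B) (r s : ℝ) :
    flow w (r + s) = flow w r ∘ flow w s := by
  funext x
  have hf := flow_isFlow hw hB
  have h := ODE_solution_unique_univ (v := fun _ => w) (s := fun _ => univ) (K := C) (t₀ := 0)
    (f := fun t => flow w (t + s) x) (g := fun t => flow w t (flow w s x))
    (fun _ => hw.lipschitzOnWith)
    (fun t => ⟨((hf x).2 (t + s)).comp_add_const t s, mem_univ _⟩)
    (fun t => ⟨(hf _).2 t, mem_univ _⟩) (by simp [flow_zero])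
  exact congrFun h r

/-- For `K > 0` this is `(e^y - 1) / K ≤ x e^y` with `y = K x`, that is `1 - y ≤ e^{-y}`. The
right-hand side is linear in `ε` and needs no case split at `K = 0`. -/
lemma gronwallBound_zero_le {K ε x : ℝ} (hK : 0 ≤ K) (hε : 0 ≤ ε) :
    gronwallBound 0 K ε x ≤ ε * x * Real.exp (K * x) := by
  rcases hK.eq_or_lt with rfl | hK
  · simp [gronwallBound_K0]
  · rw [gronwallBound_of_K_ne_0 hK.ne']
    beta_reduce
    rw [zero_mul, zero_add, div_mul_eq_mul_div, div_le_iff₀ hK]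
    have h1 : 1 - K * x ≤ Real.exp (-(K * x)) := by
      linarith [Real.add_one_le_exp (-(K * x))]
    have h2 : (1 - K * x) * Real.exp (K * x) ≤ 1 := by
      calc (1 - K * x) * Real.exp (K * x)
          ≤ Real.exp (-(K * x)) * Real.exp (K * x) := by gcongr
        _ = 1 := by rw [← Real.exp_add]; simp
    nlinarith

/-- Two flows of fields at uniform distance `δ` separate at most like `δ s e^{Cs}`. -/
lemma dist_flow_flow_le (hw : LipschitzWith C w) (hB : ∀ x, ‖w x‖ ≤ B) (hu : LipschitzWith C' u)
    (hB' : ∀ x, ‖u x‖ ≤ B') {δ : ℝ} (hδ : ∀ x, ‖w x - u x‖ ≤ δ) {s : ℝ} (hs : 0 ≤ s) (x : Sp d) :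
    dist (flow w s x) (flow u s x) ≤ δ * s * Real.exp (C * s) := by
  have hf := flow_isFlow hw hB
  have hg := flow_isFlow hu hB'
  have h := dist_le_of_approx_trajectories_ODE (v := fun _ => w) (K := C) (a := 0) (b := s)
    (f := fun t => flow w t x) (g := fun t => flow u t x) (δ := 0) (εf := 0) (εg := δ)
    (fun _ => hw)
    (flow_continuous hw hB x).continuousOn (fun t _ => ((hf x).2 t).hasDerivWithinAt)
    (fun t _ => (dist_self _).le)
    (flow_continuous hu hB' x).continuousOn (fun t _ => ((hg x).2 t).hasDerivWithinAt)
    (fun t _ => by rw [dist_comm, dist_eq_norm]; exact hδ _)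
    (by simp [flow_zero]) s ⟨hs, le_rfl⟩
  rw [zero_add, sub_zero] at h
  exact h.trans (gronwallBound_zero_le C.coe_nonneg ((norm_nonneg _).trans (hδ 0)))

end Flow

/-! ### Estimates for one step of the scheme -/

lemma map_map_signed (σ : Ms d) {f g : Sp d → Sp d} (hf : Measurable f) (hg : Measurable g) :
    (σ.map f).map g = σ.map (g ∘ f) := by
  ext s hs
  rw [VectorMeasure.map_apply _ hg hs, VectorMeasure.map_apply _ hf (hg hs),
    VectorMeasure.map_apply _ (hg.comp hf) hs, preimage_comp]

lemma sub_smul_signed (r s : ℝ) (σ : Ms d) : (r - s) • σ = r • σ - s • σ := by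
  ext t _
  exact sub_mul r s (σ t)

lemma add_smul_signed (r s : ℝ) (σ : Ms d) : (r + s) • σ = r • σ + s • σ := by
  ext t _
  exact add_mul r s (σ t)

lemma H2.lipschitz {L : ℝ≥0} {M : ℝ} {v : Ms d → Sp d → Sp d} (hv : H2 L M v) (μ : Ms d) :
    LipschitzWith L (v μ) :=
  LipschitzWith.of_dist_le_mul fun x y => by
    rw [dist_eq_norm, dist_eq_norm]
    exact (hv μ).1 x y

section Step

variable {a b K Q P R : ℝ} {L M : ℝ≥0} {v : Ms d → Sp d → Sp d} {h : Ms d → Ms d}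

lemma mass_splitStep_le (hv : H2 L M v) (hh : H3 a b Q P R h) {s : ℝ} (hs : 0 ≤ s) (μ : Ms d) :
    mass (splitStep v h s μ) ≤ mass μ + s * P := by
  refine (mass_add_le _ _).trans (add_le_add ?_ ?_)
  · exact mass_map_le _ (flow_measurable (hv.lipschitz μ) (hv μ).2 hs)
  · exact (mass_smul_le hs _).trans (mul_le_mul_of_nonneg_left (hh.2 μ).1 hs)

lemma gNorm_source_le (ha : 0 < a) (hb : 0 < b) (hh : H3 a b Q P R h) (μ : Ms d) :
    gNorm a b (h μ) ≤ a * P :=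
  (gNorm_le_mass ha hb _).trans (mul_le_mul_of_nonneg_left (hh.2 μ).1 ha.le)

lemma gNorm_splitStep_sub_le_abs (ha : 0 < a) (hb : 0 < b) (hv : H2 L M v)
    (hh : H3 a b Q P R h) {r s m : ℝ} (hr : 0 ≤ r) (hs : 0 ≤ s) {μ : Ms d} (hm : mass μ ≤ m) :
    gNorm a b (splitStep v h r μ - splitStep v h s μ) ≤ (b * M * m + a * P) * |r - s| := by
  -- `gNorm_smul_le` applies only to nonnegative factors, here `r - s`.
  wlog hrs : s ≤ r generalizing r s
  · rw [gNorm_sub_comm ha hb, abs_sub_comm]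
    exact this hs hr (le_of_not_ge hrs)
  have hl := hv.lipschitz μ
  have e : splitStep v h r μ - splitStep v h s μ =
      (μ.map (flow (v μ) r) - μ.map (flow (v μ) s)) + (r - s) • h μ := by
    rw [splitStep, splitStep, sub_smul_signed]
    abel
  rw [e]
  refine (gNorm_add_le ha hb _ _).trans ?_
  have h1 := gNorm_map_sub_map_le ha hb (flow_measurable hl (hv μ).2 hr)
    (flow_measurable hl (hv μ).2 hs) (fun x => flow_dist_flow_le hl (hv μ).2 x r s) μ
  have h2 := (gNorm_smul_le ha hb (sub_nonneg.2 hrs) (h μ)).trans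
    (mul_le_mul_of_nonneg_left (gNorm_source_le ha hb hh μ) (sub_nonneg.2 hrs))
  have h3 : b * (M * |r - s| * mass μ) ≤ b * (M * |r - s| * m) := by gcongr
  rw [abs_of_nonneg (sub_nonneg.2 hrs)] at *
  linarith

/-- Dependence of one step on the initial datum. -/
lemma gNorm_splitStep_sub_splitStep_le (ha : 0 < a) (hb : 0 < b) (hK : 0 ≤ K) (hQ : 0 ≤ Q)
    (hv1 : H1 a b K v) (hv : H2 L M v) (hh : H3 a b Q P R h) {s m : ℝ} (hs : 0 ≤ s)
    (μ : Ms d) {ν : Ms d} (hm : mass ν ≤ m) :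
    gNorm a b (splitStep v h s μ - splitStep v h s ν) ≤
      Real.exp ((L + b * m * K + Q) * s) * gNorm a b (μ - ν) := by
  set D := gNorm a b (μ - ν) with hD
  have hD0 : 0 ≤ D := gNorm_nonneg _ _ _
  have hm0 : 0 ≤ m := (mass_nonneg _).trans hm
  have lμ := hv.lipschitz μ
  have lν := hv.lipschitz ν
  -- Three contributions: the initial difference carried by one flow, the two flows acting on the
  -- same `ν` (hence a mass bound on `ν` alone), and the sources.
  have e : splitStep v h s μ - splitStep v h s ν =
      (μ - ν).map (flow (v μ) s) + (ν.map (flow (v μ) s) - ν.map (flow (v ν) s)) +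
        s • (h μ - h ν) := by
    rw [splitStep, splitStep, smul_sub_signed, map_sub]
    abel
  have hexp : 1 ≤ Real.exp (L * s) := Real.one_le_exp (by positivity)
  have h1 : gNorm a b ((μ - ν).map (flow (v μ) s)) ≤ Real.exp (L * s) * D := by
    have := gNorm_map_le ha hb (by rwa [Real.one_le_toNNReal])
      (flow_lipschitz lμ (hv μ).2 hs) (μ - ν)
    rwa [Real.coe_toNNReal _ (Real.exp_pos _).le] at this
  have h2 := gNorm_map_sub_map_le ha hb (flow_measurable lμ (hv μ).2 hs)
    (flow_measurable lν (hv ν).2 hs)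
    (dist_flow_flow_le lμ (hv μ).2 lν (hv ν).2 (hv1 μ ν) hs) ν
  rw [← hD] at h2
  have h2' : b * (K * D * s * Real.exp (L * s) * mass ν) ≤
      b * (K * D * s * Real.exp (L * s) * m) := by gcongr
  have h3 : gNorm a b (s • (h μ - h ν)) ≤ s * (Q * D) :=
    (gNorm_smul_le ha hb hs _).trans (mul_le_mul_of_nonneg_left (hh.1 μ ν) hs)
  -- The source term is inflated by `exp (L s)` so that the sum becomes `exp (L s) D (1 + (b m K +
  -- Q) s)`.
  have h3' : s * (Q * D) ≤ Real.exp (L * s) * (s * (Q * D)) :=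
    le_mul_of_one_le_left (by positivity) hexp
  have h4 : 1 + (b * m * K + Q) * s ≤ Real.exp ((b * m * K + Q) * s) := by
    linarith [Real.add_one_le_exp ((b * m * K + Q) * s)]
  have h5 : Real.exp (L * s) * D * (1 + (b * m * K + Q) * s) ≤
      Real.exp (L * s) * D * Real.exp ((b * m * K + Q) * s) := by gcongr
  have h6 : Real.exp ((L + b * m * K + Q) * s) =
      Real.exp (L * s) * Real.exp ((b * m * K + Q) * s) := by
    rw [← Real.exp_add]
    congr 1
    ring
  rw [e, h6]
  have h7 := gNorm_add_le ha hb
    ((μ - ν).map (flow (v μ) s) + (ν.map (flow (v μ) s) - ν.map (flow (v ν) s))) (s • (h μ - h ν))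
  have h8 := gNorm_add_le ha hb ((μ - ν).map (flow (v μ) s))
    (ν.map (flow (v μ) s) - ν.map (flow (v ν) s))
  linarith

/-- Two half steps differ from one full step by an error of second order. -/
lemma gNorm_splitStep_splitStep_sub_le (ha : 0 < a) (hb : 0 < b) (hK : 0 ≤ K) (hQ : 0 ≤ Q)
    (hv1 : H1 a b K v) (hv : H2 L M v) (hh : H3 a b Q P R h) {s m : ℝ} (hs : 0 ≤ s) (hs1 : s ≤ 1)
    {μ : Ms d} (hm : mass μ ≤ m) :
    gNorm a b (splitStep v h s (splitStep v h s μ) - splitStep v h (s + s) μ) ≤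
      (b * m * K * (b * M * m + a * P) * Real.exp L + b * M * P + Q * (b * M * m + a * P)) *
        s ^ 2 := by
  set Λ := b * M * m + a * P
  set ν := splitStep v h s μ with hν
  have hP : 0 ≤ P := (mass_nonneg _).trans (hh.2 μ).1
  have hm0 : 0 ≤ m := (mass_nonneg _).trans hm
  have hΛ : 0 ≤ Λ := by positivity
  have lμ := hv.lipschitz μ
  have lν := hv.lipschitz ν
  have fμ := flow_measurable lμ (hv μ).2 hs
  have fν := flow_measurable lν (hv ν).2 hs
  have hd : gNorm a b (ν - μ) ≤ Λ * s := by
    have := gNorm_splitStep_sub_le_abs ha hb hv hh hs le_rfl hm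
    rwa [splitStep_zero, sub_zero, abs_of_nonneg hs] at this
  set ρ := μ.map (flow (v μ) s) with hρ
  -- Each term is `O(s²)`: fields at distance `K Λ s` acting during time `s`; the first half-step
  -- source `s h[μ]`, displaced by at most `M s`; and `s` times a source variation of at most `Q Λ
  -- s`.
  have e : splitStep v h s ν - splitStep v h (s + s) μ =
      (ρ.map (flow (v ν) s) - ρ.map (flow (v μ) s)) +
        s • ((h μ).map (flow (v ν) s) - (h μ).map id) + s • (h ν - h μ) := by
    have e1 : splitStep v h s ν = ρ.map (flow (v ν) s) + s • (h μ).map (flow (v ν) s) +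
        s • h ν := by
      change (ρ + s • h μ).map (flow (v ν) s) + s • h ν = _
      rw [VectorMeasure.map_add, VectorMeasure.map_smul]
    have e2 : splitStep v h (s + s) μ = ρ.map (flow (v μ) s) + (s • h μ + s • h μ) := by
      rw [splitStep, flow_add lμ (hv μ).2, ← map_map_signed _ fμ fμ, add_smul_signed]
    rw [e1, e2, VectorMeasure.map_id, smul_sub_signed, smul_sub_signed]
    abel
  have hmρ : mass ρ ≤ m := (mass_map_le _ fμ).trans hm
  have h1 := gNorm_map_sub_map_le ha hb fν fμ
    (dist_flow_flow_le lν (hv ν).2 lμ (hv μ).2 (hv1 ν μ) hs) ρ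
  have hexp : Real.exp (L * s) ≤ Real.exp L :=
    Real.exp_le_exp.2 (mul_le_of_le_one_right L.coe_nonneg hs1)
  have h1' : b * (K * gNorm a b (ν - μ) * s * Real.exp (L * s) * mass ρ) ≤
      b * (K * (Λ * s) * s * Real.exp L * m) := by
    gcongr
    exact mass_nonneg _
  have h2 : gNorm a b ((h μ).map (flow (v ν) s) - (h μ).map id) ≤ b * (M * s * P) := by
    refine (gNorm_map_sub_map_le ha hb fν measurable_id (D := M * s) (fun x => ?_) _).trans ?_
    · have := flow_dist_flow_le lν (hv ν).2 x s 0
      rwa [flow_zero, sub_zero, abs_of_nonneg hs] at this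
    · have := (hh.2 μ).1
      gcongr
  have h2' := (gNorm_smul_le ha hb hs ((h μ).map (flow (v ν) s) - (h μ).map id)).trans
    (mul_le_mul_of_nonneg_left h2 hs)
  have h3 := (gNorm_smul_le ha hb hs (h ν - h μ)).trans
    (mul_le_mul_of_nonneg_left ((hh.1 ν μ).trans (mul_le_mul_of_nonneg_left hd hQ)) hs)
  rw [e]
  have h4 := gNorm_add_le ha hb ((ρ.map (flow (v ν) s) - ρ.map (flow (v μ) s)) +
    s • ((h μ).map (flow (v ν) s) - (h μ).map id)) (s • (h ν - h μ))
  have h5 := gNorm_add_le ha hb (ρ.map (flow (v ν) s) - ρ.map (flow (v μ) s))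
    (s • ((h μ).map (flow (v ν) s) - (h μ).map id))
  linarith

/-! ### The support of one step -/

lemma supp_subset_iff {σ : Ms d} {S : Set (Sp d)} (hS : IsClosed S) :
    supp σ ⊆ S ↔ σ.totalVariation Sᶜ = 0 :=
  ⟨fun hσ => measure_mono_null (compl_subset_compl.2 hσ) Measure.measure_compl_support,
    fun hσ => Measure.support_subset_of_isClosed hS hσ⟩

/-- In time `s` the flow moves points by at most `s M`, so whatever lands outside the larger ball
started outside the smaller one, where `μ` has no mass. -/
lemma supp_splitStep_subset (hv : H2 L M v) {s r : ℝ} (hs : 0 ≤ s) {μ : Ms d}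
    (hμ : supp μ ⊆ Metric.closedBall 0 r) (hhμ : supp (h μ) ⊆ Metric.closedBall 0 (r + s * M)) :
    supp (splitStep v h s μ) ⊆ Metric.closedBall 0 (r + s * M) := by
  have hl := hv.lipschitz μ
  have hf := flow_measurable hl (hv μ).2 hs
  rw [supp_subset_iff Metric.isClosed_closedBall] at *
  set S : Set (Sp d) := (Metric.closedBall 0 (r + s * M))ᶜ
  have hS : MeasurableSet S := Metric.isClosed_closedBall.measurableSet.compl
  lift s to ℝ≥0 using hs
  have e : splitStep v h s μ = sgn ((pos μ).map (flow (v μ) s) + s • pos (h μ)) -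
      sgn ((neg μ).map (flow (v μ) s) + s • neg (h μ)) := by
    rw [sgn_add, sgn_add, sgn_smul, sgn_smul, splitStep, map_eq_sgn_sub μ hf]
    nth_rw 1 [← sgn_pos_sub_sgn_neg (h μ)]
    rw [smul_sub_signed]
    abel
  refine le_antisymm ((totalVariation_le e S).trans (le_of_eq ?_)) bot_le
  have hpre : flow (v μ) s ⁻¹' S ⊆ (Metric.closedBall 0 r)ᶜ := fun x hx hx' => hx <| by
    rw [mem_closedBall_zero_iff] at *
    exact (norm_flow_le hl (hv μ).2 x s.2).trans (add_le_add hx' le_rfl)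
  rw [SignedMeasure.totalVariation, Measure.add_apply, add_eq_zero] at hμ hhμ
  have z1 : (pos μ : Measure (Sp d)) (flow (v μ) s ⁻¹' S) = 0 := measure_mono_null hpre hμ.1
  have z2 : (neg μ : Measure (Sp d)) (flow (v μ) s ⁻¹' S) = 0 := measure_mono_null hpre hμ.2
  have z3 : (pos (h μ) : Measure (Sp d)) S = 0 := hhμ.1
  have z4 : (neg (h μ) : Measure (Sp d)) S = 0 := hhμ.2
  simp [Measure.map_apply hf hS, z1, z2, z3, z4]

end Step

/-! ### Estimates for the scheme -/

section Scheme

variable {a b K Q P R : ℝ} {L M : ℝ≥0} {v : Ms d → Sp d → Sp d} {h : Ms d → Ms d} {μ₀ : Ms d}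

lemma nonneg_of_H3 (hh : H3 a b Q P R h) : 0 ≤ P := (mass_nonneg _).trans (hh.2 0).1

lemma floor_step_le (k : ℕ) {t : ℝ} (ht : 0 ≤ t) : (⌊t * 2 ^ k⌋₊ : ℝ) * (1 / 2 ^ k) ≤ t := by
  rw [mul_one_div, div_le_iff₀ (by positivity)]
  exact Nat.floor_le (by positivity)

lemma lt_floor_step (k : ℕ) (t : ℝ) : t < ((⌊t * 2 ^ k⌋₊ : ℝ) + 1) * (1 / 2 ^ k) := by
  rw [mul_one_div, lt_div_iff₀ (by positivity)]
  exact Nat.lt_floor_add_one _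

lemma floor_step_index_le (k : ℕ) {t : ℝ} (ht : t ≤ 1) : ⌊t * 2 ^ k⌋₊ ≤ 2 ^ k := by
  refine Nat.floor_le_of_le ?_
  push_cast
  exact mul_le_of_le_one_left (by positivity) ht

lemma step_mul_le_one {k i : ℕ} (hi : i ≤ 2 ^ k) : (i : ℝ) * (1 / 2 ^ k) ≤ 1 := by
  rw [mul_one_div, div_le_one (by positivity)]
  exact_mod_cast hi

lemma mass_gridVal_le (hv : H2 L M v) (hh : H3 a b Q P R h) (k i : ℕ) :
    mass (gridVal v h μ₀ k i) ≤ mass μ₀ + i * (1 / 2 ^ k) * P := by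
  induction i with
  | zero => simp [gridVal]
  | succ i ih =>
    refine (mass_splitStep_le hv hh (by positivity) _).trans ?_
    push_cast
    linarith

lemma mass_gridVal_le_of_le (hv : H2 L M v) (hh : H3 a b Q P R h) {k i : ℕ} (hi : i ≤ 2 ^ k) :
    mass (gridVal v h μ₀ k i) ≤ mass μ₀ + P :=
  (mass_gridVal_le hv hh k i).trans
    (add_le_add le_rfl (mul_le_of_le_one_left (nonneg_of_H3 hh) (step_mul_le_one hi)))

lemma mass_scheme_le (hv : H2 L M v) (hh : H3 a b Q P R h) (k : ℕ) {t : ℝ} (ht : 0 ≤ t) :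
    mass (scheme v h μ₀ k t) ≤ P * t + mass μ₀ := by
  refine (mass_splitStep_le hv hh (sub_nonneg.2 (floor_step_le k ht)) _).trans ?_
  linarith [mass_gridVal_le (μ₀ := μ₀) hv hh k ⌊t * 2 ^ k⌋₊]

lemma supp_gridVal_subset (hv : H2 L M v) {r : ℝ} (hμ₀ : supp μ₀ ⊆ Metric.closedBall 0 r)
    (hh : ∀ μ, supp (h μ) ⊆ Metric.closedBall 0 r) (k i : ℕ) :
    supp (gridVal v h μ₀ k i) ⊆ Metric.closedBall 0 (r + i * (1 / 2 ^ k) * M) := by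
  induction i with
  | zero => simpa [gridVal] using hμ₀
  | succ i ih =>
    have e : r + ((i + 1 : ℕ) : ℝ) * (1 / 2 ^ k) * M =
        r + i * (1 / 2 ^ k) * M + 1 / 2 ^ k * M := by
      push_cast
      ring
    rw [e]
    refine supp_splitStep_subset hv (by positivity) ih ((hh _).trans ?_)
    refine Metric.closedBall_subset_closedBall ?_
    rw [add_assoc]
    exact le_add_of_nonneg_right (by positivity)

lemma supp_scheme_subset (hv : H2 L M v) {r : ℝ} (hμ₀ : supp μ₀ ⊆ Metric.closedBall 0 r)
    (hh : ∀ μ, supp (h μ) ⊆ Metric.closedBall 0 r) (k : ℕ) {t : ℝ} (ht : 0 ≤ t) :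
    supp (scheme v h μ₀ k t) ⊆ Metric.closedBall 0 (r + t * M) := by
  set i := ⌊t * 2 ^ k⌋₊ with hi
  have hs : 0 ≤ t - i * (1 / 2 ^ k) := sub_nonneg.2 (floor_step_le k ht)
  have e : r + t * M = r + i * (1 / 2 ^ k) * M + (t - i * (1 / 2 ^ k)) * M := by ring
  have hle : r ≤ r + t * M := le_add_of_nonneg_right (by positivity)
  rw [e] at *
  exact supp_splitStep_subset hv hs (supp_gridVal_subset hv hμ₀ hh k i)
    ((hh _).trans (Metric.closedBall_subset_closedBall hle))

lemma gNorm_gridVal_sub_le (ha : 0 < a) (hb : 0 < b) (hv : H2 L M v) (hh : H3 a b Q P R h)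
    {k i j : ℕ} (hij : i ≤ j) (hj : j ≤ 2 ^ k) :
    gNorm a b (gridVal v h μ₀ k j - gridVal v h μ₀ k i) ≤
      (b * M * (mass μ₀ + P) + a * P) * (j * (1 / 2 ^ k) - i * (1 / 2 ^ k)) := by
  induction j, hij using Nat.le_induction with
  | base => simp [gNorm_zero ha hb]
  | succ j hij ih =>
    have h1 := gNorm_splitStep_sub_le_abs ha hb hv hh (r := 1 / 2 ^ k) (s := 0) (by positivity)
      le_rfl (mass_gridVal_le_of_le (μ₀ := μ₀) hv hh (by omega : j ≤ 2 ^ k))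
    rw [splitStep_zero, sub_zero, abs_of_nonneg (by positivity)] at h1
    refine (gNorm_sub_le_add ha hb _ (gridVal v h μ₀ k j) _).trans
      ((add_le_add h1 (ih (by omega))).trans (le_of_eq ?_))
    push_cast
    ring

/-- The approximate solutions are Lipschitz in time, uniformly in `k`. -/
lemma gNorm_scheme_sub_le (ha : 0 < a) (hb : 0 < b) (hv : H2 L M v) (hh : H3 a b Q P R h)
    (k : ℕ) {s t : ℝ} (hs : 0 ≤ s) (hst : s ≤ t) (ht : t ≤ 1) :
    gNorm a b (scheme v h μ₀ k t - scheme v h μ₀ k s) ≤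
      (b * M * (mass μ₀ + P) + a * P) * (t - s) := by
  have hi := floor_step_index_le k (hst.trans ht)
  have hj := floor_step_index_le k ht
  have hij : ⌊s * 2 ^ k⌋₊ ≤ ⌊t * 2 ^ k⌋₊ := Nat.floor_mono (by gcongr)
  have hi0 := floor_step_le k hs
  have hj0 := floor_step_le k (hs.trans hst)
  have hi1 := lt_floor_step k s
  rw [scheme, scheme]
  set i := ⌊s * 2 ^ k⌋₊
  set j := ⌊t * 2 ^ k⌋₊
  set Λ := b * M * (mass μ₀ + P) + a * P
  have step : ∀ {l : ℕ} {r r' : ℝ}, l ≤ 2 ^ k → 0 ≤ r' → r' ≤ r →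
      gNorm a b (splitStep v h r (gridVal v h μ₀ k l) - splitStep v h r' (gridVal v h μ₀ k l)) ≤
        Λ * (r - r') := by
    intro l r r' hl hr' hr
    have := gNorm_splitStep_sub_le_abs ha hb hv hh (hr'.trans hr) hr'
      (mass_gridVal_le_of_le (μ₀ := μ₀) hv hh hl)
    rwa [abs_of_nonneg (sub_nonneg.2 hr)] at this
  rcases hij.eq_or_lt with heq | hlt
  · rw [← heq] at hj0 ⊢
    refine (step hi (by linarith) (by linarith)).trans (le_of_eq ?_)
    ring
  -- Different cells: the path goes from `t` down to `jΔt`, along the grid to `(i+1)Δt`, then to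
  -- `s`; the three lengths add up to `t - s`.
  · have h1 := step (r := t - j * (1 / 2 ^ k)) hj le_rfl (by linarith)
    rw [splitStep_zero] at h1
    have h2 := gNorm_gridVal_sub_le (μ₀ := μ₀) ha hb hv hh (k := k) (i := i + 1) (j := j) hlt hj
    have h3 := step (r := 1 / 2 ^ k) (r' := s - i * (1 / 2 ^ k)) hi (by linarith) (by linarith)
    change gNorm a b (gridVal v h μ₀ k (i + 1) - _) ≤ _ at h3
    refine (gNorm_sub_le_add ha hb _ (gridVal v h μ₀ k j) _).trans ((add_le_add h1
      ((gNorm_sub_le_add ha hb _ (gridVal v h μ₀ k (i + 1)) _).trans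
        (add_le_add h2 h3))).trans (le_of_eq ?_))
    push_cast
    ring

lemma isContCurve_scheme (ha : 0 < a) (hb : 0 < b) (hv : H2 L M v) (hh : H3 a b Q P R h)
    (k : ℕ) : IsContCurve a b (scheme v h μ₀ k) := by
  intro t ht
  set Λ := b * M * (mass μ₀ + P) + a * P
  have hlim : Tendsto (fun s => Λ * |s - t|) (𝓝[Icc 0 1] t) (𝓝 0) := by
    have hc : Continuous fun s : ℝ => Λ * |s - t| := by fun_prop
    have := hc.tendsto t
    rw [sub_self, abs_zero, mul_zero] at this
    exact this.mono_left nhdsWithin_le_nhds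
  refine tendsto_of_tendsto_of_tendsto_of_le_of_le' tendsto_const_nhds hlim
    (Eventually.of_forall fun s => gNorm_nonneg _ _ _) ?_
  filter_upwards [self_mem_nhdsWithin] with s hs
  rcases le_total s t with hst | hst
  · rw [gNorm_sub_comm ha hb, abs_sub_comm, abs_of_nonneg (sub_nonneg.2 hst)]
    exact gNorm_scheme_sub_le ha hb hv hh k hs.1 hst ht.2
  · rw [abs_of_nonneg (sub_nonneg.2 hst)]
    exact gNorm_scheme_sub_le ha hb hv hh k ht.1 hst hs.2

/-- Halving the time step changes the values at the coarse grid points by `O(2⁻ᵏ)`. -/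
lemma exists_gNorm_gridVal_succ_sub_le (ha : 0 < a) (hb : 0 < b) (hK : 0 ≤ K) (hQ : 0 ≤ Q)
    (hv1 : H1 a b K v) (hv : H2 L M v) (hh : H3 a b Q P R h) (μ₀ : Ms d) :
    ∃ E : ℝ, 0 ≤ E ∧ ∀ k i : ℕ, i ≤ 2 ^ k →
      gNorm a b (gridVal v h μ₀ (k + 1) (2 * i) - gridVal v h μ₀ k i) ≤ E * (1 / 2 ^ k) := by
  have hP : 0 ≤ P := nonneg_of_H3 hh
  set m := mass μ₀ + P
  have hm0 : 0 ≤ m := add_nonneg (mass_nonneg _) hP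
  set A := (L : ℝ) + b * m * K + Q
  have hA : 0 ≤ A := by positivity
  set B := b * m * K * (b * M * m + a * P) * Real.exp L + b * M * P + Q * (b * M * m + a * P)
  have hB : 0 ≤ B := by positivity
  -- `B` is the consistency constant and `exp A` bounds the amplification accumulated over the unit
  -- interval.
  refine ⟨B * Real.exp A, by positivity, fun k => ?_⟩
  set s : ℝ := 1 / 2 ^ (k + 1) with hs
  have hs0 : 0 ≤ s := by positivity
  have hss : s + s = 1 / 2 ^ k := by
    rw [hs, pow_succ]
    field_simp
    norm_num
  have hs1 : s + s ≤ 1 := by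
    rw [hss]
    exact (div_le_one (by positivity)).2 (one_le_pow₀ one_le_two)
  set q := Real.exp (A * (1 / 2 ^ k)) with hq
  have hq1 : 1 ≤ q := Real.one_le_exp (by positivity)
  have hqs : Real.exp (A * s) * Real.exp (A * s) = q := by
    rw [hq, ← hss, mul_add, Real.exp_add]
  -- Discrete Gronwall: each coarse step multiplies the previous error by `q` and adds a local error
  -- `B s²`.
  have err : ∀ i : ℕ, i ≤ 2 ^ k →
      gNorm a b (gridVal v h μ₀ (k + 1) (2 * i) - gridVal v h μ₀ k i) ≤
        i * (B * s ^ 2) * q ^ i := by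
    intro i
    induction i with
    | zero => intro _; simp [gridVal, gNorm_zero ha hb]
    | succ i ih =>
      intro hi
      have ih := ih (by omega)
      set x := gridVal v h μ₀ (k + 1) (2 * i)
      set y := gridVal v h μ₀ k i
      have ex : gridVal v h μ₀ (k + 1) (2 * (i + 1)) = splitStep v h s (splitStep v h s x) := rfl
      have ey : gridVal v h μ₀ k (i + 1) = splitStep v h (s + s) y := by rw [hss]; rfl
      have hy : mass y ≤ m := mass_gridVal_le_of_le hv hh (by omega)
      -- The half step ends before time `(i+1)Δt ≤ 1`, so the uniform mass bound still holds.
      have hy' : mass (splitStep v h s y) ≤ m := by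
        refine (mass_splitStep_le hv hh hs0 _).trans ?_
        have h1 := mass_gridVal_le (μ₀ := μ₀) hv hh k i
        have h2 := step_mul_le_one hi
        push_cast at h2
        have h3 : ((i : ℝ) * (1 / 2 ^ k) + s) * P ≤ P :=
          mul_le_of_le_one_left hP (by linarith)
        linarith
      have c1 := gNorm_splitStep_sub_splitStep_le ha hb hK hQ hv1 hv hh hs0
        (splitStep v h s x) hy'
      have c2 := gNorm_splitStep_sub_splitStep_le ha hb hK hQ hv1 hv hh hs0 x hy
      have c3 := gNorm_splitStep_splitStep_sub_le ha hb hK hQ hv1 hv hh hs0 (by linarith) hy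
      change _ ≤ B * s ^ 2 at c3
      have c12 : gNorm a b (splitStep v h s (splitStep v h s x) -
          splitStep v h s (splitStep v h s y)) ≤ q * gNorm a b (x - y) := by
        rw [← hqs, mul_assoc]
        exact c1.trans (mul_le_mul_of_nonneg_left c2 (Real.exp_pos _).le)
      rw [ex, ey]
      refine (gNorm_sub_le_add ha hb _ (splitStep v h s (splitStep v h s y)) _).trans
        ((add_le_add (c12.trans (mul_le_mul_of_nonneg_left ih (by positivity))) c3).trans ?_)
      have h4 : B * s ^ 2 ≤ B * s ^ 2 * q ^ (i + 1) :=
        le_mul_of_one_le_right (by positivity) (one_le_pow₀ hq1)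
      push_cast
      rw [pow_succ q i] at h4 ⊢
      linarith
  intro i hi
  refine (err i hi).trans ?_
  have hqi : q ^ i ≤ Real.exp A := by
    rw [hq, ← Real.exp_nat_mul]
    refine Real.exp_le_exp.2 ?_
    have := mul_le_mul_of_nonneg_left (step_mul_le_one hi) hA
    linarith
  have his : (i : ℝ) * s ^ 2 ≤ 1 / 2 ^ k := by
    have h1 : (i : ℝ) * (s + s) ≤ 1 := by
      rw [hss]
      exact step_mul_le_one hi
    rw [← hss]
    nlinarith
  calc (i : ℝ) * (B * s ^ 2) * q ^ i = B * q ^ i * (i * s ^ 2) := by ring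
    _ ≤ B * Real.exp A * (1 / 2 ^ k) := by gcongr

/-- The last coarse grid time `τ ≤ t` is also a fine grid time, of index `2i`. The grid error is
compared there, and both curves move by at most `Λ 2⁻ᵏ` between `τ` and `t`. -/
lemma exists_gNorm_scheme_succ_sub_le (ha : 0 < a) (hb : 0 < b) (hK : 0 ≤ K) (hQ : 0 ≤ Q)
    (hv1 : H1 a b K v) (hv : H2 L M v) (hh : H3 a b Q P R h) (μ₀ : Ms d) :
    ∃ E : ℝ, 0 ≤ E ∧ ∀ (k : ℕ) (t : ℝ), t ∈ Icc (0 : ℝ) 1 →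
      gNorm a b (scheme v h μ₀ (k + 1) t - scheme v h μ₀ k t) ≤ E * (1 / 2 ^ k) := by
  obtain ⟨E, hE, hgrid⟩ := exists_gNorm_gridVal_succ_sub_le ha hb hK hQ hv1 hv hh μ₀
  have hP : 0 ≤ P := nonneg_of_H3 hh
  have hm0 := mass_nonneg μ₀
  set Λ := b * M * (mass μ₀ + P) + a * P
  have hΛ : 0 ≤ Λ := by positivity
  refine ⟨2 * Λ + E, by positivity, fun k t ht => ?_⟩
  have h0 := floor_step_le k ht.1
  have h1 := lt_floor_step k t
  have hg := hgrid k _ (floor_step_index_le k ht.2)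
  set i := ⌊t * 2 ^ k⌋₊
  set τ : ℝ := i * (1 / 2 ^ k) with hτ
  have hτ0 : 0 ≤ τ := by positivity
  have e : τ = ((2 * i : ℕ) : ℝ) * (1 / 2 ^ (k + 1)) := by
    rw [hτ, pow_succ]
    push_cast
    field_simp
  rw [← scheme_grid v h μ₀ (k + 1), ← scheme_grid v h μ₀ k, ← e] at hg
  have c1 := gNorm_scheme_sub_le (μ₀ := μ₀) ha hb hv hh (k + 1) hτ0 h0 ht.2
  have c2 := gNorm_scheme_sub_le (μ₀ := μ₀) ha hb hv hh k hτ0 h0 ht.2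
  rw [gNorm_sub_comm ha hb] at c2
  have hle : Λ * (t - τ) ≤ Λ * (1 / 2 ^ k) := mul_le_mul_of_nonneg_left (by linarith) hΛ
  have t1 := gNorm_sub_le_add ha hb (scheme v h μ₀ (k + 1) t) (scheme v h μ₀ (k + 1) τ)
    (scheme v h μ₀ k t)
  have t2 := gNorm_sub_le_add ha hb (scheme v h μ₀ (k + 1) τ) (scheme v h μ₀ k τ)
    (scheme v h μ₀ k t)
  linarith

lemma isCauchyInC0_scheme (ha : 0 < a) (hb : 0 < b) (hK : 0 ≤ K) (hQ : 0 ≤ Q)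
    (hv1 : H1 a b K v) (hv : H2 L M v) (hh : H3 a b Q P R h) (μ₀ : Ms d) :
    IsCauchyInC0 a b (scheme v h μ₀) := by
  refine ⟨isContCurve_scheme ha hb hv hh, fun ε hε => ?_⟩
  obtain ⟨E, hE, hsucc⟩ := exists_gNorm_scheme_succ_sub_le ha hb hK hQ hv1 hv hh μ₀
  -- The subtracted tail makes the induction exact: `E / 2^m = 2E / 2^m - 2E / 2^(m+1)`.
  have tele : ∀ n m : ℕ, n ≤ m → ∀ t ∈ Icc (0 : ℝ) 1,
      gNorm a b (scheme v h μ₀ m t - scheme v h μ₀ n t) ≤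
        2 * E * (1 / 2 ^ n) - 2 * E * (1 / 2 ^ m) := by
    intro n m hnm t ht
    induction m, hnm using Nat.le_induction with
    | base => simp [gNorm_zero ha hb]
    | succ m _ ih =>
      refine (gNorm_sub_le_add ha hb _ (scheme v h μ₀ m t) _).trans
        ((add_le_add (hsucc m t ht) ih).trans (le_of_eq ?_))
      rw [pow_succ]
      field_simp
      ring
  -- The `+ 1` keeps the denominator positive when `E = 0`.
  obtain ⟨N, hN⟩ := exists_pow_lt_of_lt_one (div_pos hε (by positivity : 0 < 2 * E + 1))
    (by norm_num : (1 / 2 : ℝ) < 1)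
  have hlt : 2 * E * (1 / 2 ^ N) < ε := by
    rw [one_div_pow, lt_div_iff₀ (by positivity)] at hN
    have : (0 : ℝ) < 1 / 2 ^ N := by positivity
    linarith
  have close : ∀ n m : ℕ, N ≤ n → n ≤ m → ∀ t ∈ Icc (0 : ℝ) 1,
      gNorm a b (scheme v h μ₀ m t - scheme v h μ₀ n t) ≤ 2 * E * (1 / 2 ^ N) := by
    intro n m hn hnm t ht
    have h1 : (1 : ℝ) / 2 ^ n ≤ 1 / 2 ^ N :=
      one_div_le_one_div_of_le (by positivity) (pow_le_pow_right₀ one_le_two hn)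
    have h2 := mul_le_mul_of_nonneg_left h1 (by positivity : 0 ≤ 2 * E)
    have h3 : 0 ≤ 2 * E * (1 / 2 ^ m) := by positivity
    linarith [tele n m hnm t ht]
  refine ⟨N, fun m hm n hn => ?_⟩
  refine lt_of_le_of_lt (iSup₂_le fun t ht => ENNReal.ofReal_le_ofReal ?_)
    ((ENNReal.ofReal_lt_ofReal_iff hε).2 hlt)
  rcases le_total n m with hnm | hnm
  · exact close n m hn hnm t ht
  · rw [gNorm_sub_comm ha hb]
    exact close m n hm hnm t ht

end Scheme

end SignedTransport

end

theorem proposition34 (d : ℕ) (a b : ℝ) (ha : 0 < a) (hb : 0 < b)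
    (K L M Q P R : ℝ)
    (v : SignedTransport.Ms d → SignedTransport.Sp d → SignedTransport.Sp d)
    (h : SignedTransport.Ms d → SignedTransport.Ms d)
    (hH1 : SignedTransport.H1 a b K v)
    (hH2 : SignedTransport.H2 L M v)
    (hH3 : SignedTransport.H3 a b Q P R h)
    (μ₀ : SignedTransport.Ms d)
    (hμ₀ : IsCompact (SignedTransport.supp μ₀)) :
    SignedTransport.IsCauchyInC0 a b (SignedTransport.scheme v h μ₀) ∧
    (∀ (k : ℕ) (t : ℝ), 0 ≤ t → t ≤ 1 →
      SignedTransport.mass (SignedTransport.scheme v h μ₀ k t) ≤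
        P * t + SignedTransport.mass μ₀) ∧
    (∀ R' : ℝ,
      SignedTransport.supp μ₀ ∪ Metric.closedBall 0 R ⊆ Metric.closedBall 0 R' →
      ∀ (k : ℕ) (t : ℝ), 0 ≤ t → t ≤ 1 →
        SignedTransport.supp (SignedTransport.scheme v h μ₀ k t) ⊆
          Metric.closedBall 0 (R' + t * M)) := by
  open SignedTransport in
  have hM : 0 ≤ M := (norm_nonneg _).trans ((hH2 0).2 0)
  lift M to NNReal using hM
  -- The constants `L`, `K`, `Q` may be negative as given; replacing them by their positive parts
  -- only weakens the hypotheses.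
  have hv : H2 ((L.toNNReal : NNReal) : ℝ) M v := fun μ =>
    ⟨fun x y => ((hH2 μ).1 x y).trans
      (mul_le_mul_of_nonneg_right (Real.le_coe_toNNReal L) (norm_nonneg _)), (hH2 μ).2⟩
  have hv1 : H1 a b (max K 0) v := fun μ ν x => (hH1 μ ν x).trans
    (mul_le_mul_of_nonneg_right (le_max_left K 0) (gNorm_nonneg _ _ _))
  have hh : H3 a b (max Q 0) P R h := ⟨fun μ ν => (hH3.1 μ ν).trans
    (mul_le_mul_of_nonneg_right (le_max_left Q 0) (gNorm_nonneg _ _ _)), hH3.2⟩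
  refine ⟨isCauchyInC0_scheme ha hb (le_max_right _ _) (le_max_right _ _) hv1 hv hh μ₀,
    fun k t ht _ => mass_scheme_le hv hh k ht, fun R' hR' k t ht _ => ?_⟩
  exact supp_scheme_subset hv (Set.subset_union_left.trans hR')
    (fun μ => (hH3.2 μ).2.trans (Set.subset_union_right.trans hR')) k ht
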